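/- Let $G=\{\zeta=(u,v):u\in\mathbb{R},\,v>0\}$ with the measure $\mathrm{d}\nu=v^{-2}\,\mathrm{d}u\,\mathrm{d}v$, let $k\in\{0,1,2,\dots\}$, let $L_k$ be the Laguerre polynomial of degree $k$ and type $0$, and put $\ell_k(y)=\mathrm{e}^{-y/2}L_k(y)$. All inner products are linear in the first argument. Let $\psi^{(k)}\in L_2(\mathbb{R})$ be the wavelet with Fourier transform $\hat\psi^{(k)}(\xi)=\int_{\mathbb{R}}\psi^{(k)}(x)\mathrm{e}^{-2\pi\mathrm{i}x\xi}\,\mathrm{d}x=\sqrt{2\xi}\,\ell_k(2\xi)$ for $\xi>0$ and $\hat\psi^{(k)}(\xi)=0$ for $\xi\le 0$, and let $(\rho_\zeta f)(x)=v^{-1/2}f\left(\frac{x-u}{v}\right)$ for $\zeta=(u,v)\in G$. Let $H_2^+(\mathbb{R})$ be the Hardy space of all $f\in L_2(\mathbb{R})$ with $\operatorname{supp}\hat f\subseteq[0,\infty)$, and let $A^{(k)}\subset L_2(G,\mathrm{d}\nu)$ be the wavelet subspace of all functions $(u,v)\mapsto(f*\psi^{(k)}_v)(u)$, $f\in H_2^+(\mathbb{R})$,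 where $\psi^{(k)}_v(x)=v^{-1/2}\psi^{(k)}(x/v)$. It is a closed subspace with reproducing kernel $$K^{(k)}_\zeta(\eta)=\langle\rho_\zeta\psi^{(k)},\rho_\eta\psi^{(k)}\rangle_{L_2(\mathbb{R})},\qquad \zeta,\eta\in G.$$ Let $P^{(k)}$ be the orthogonal projection of $L_2(G,\mathrm{d}\nu)$ onto $A^{(k)}$. For a bounded measurable function $a$ on $\mathbb{R}_+=(0,\infty)$, regarded as a symbol $a(\zeta)=a(v)$ on $G$, let $T_a^{(k)}F=P^{(k)}(aF)$, $F\in A^{(k)}$, be the Calderón–Toeplitz operator. Its Wick function is $$\widetilde a_k(\zeta,\eta)=\frac{\langle T_a^{(k)}K^{(k)}_\zeta,K^{(k)}_\eta\rangle_{L_2(G,\mathrm{d}\nu)}}{\langle K^{(k)}_\zeta,K^{(k)}_\eta\rangle_{L_2(G,\mathrm{d}\nu)}}$$ at all $\zeta,\eta\in G$ with $K^{(k)}_\zeta(\eta)\neq 0$, and its Wick symbol is $\widetilde a_k(\zeta)=\widetilde a_k(\zeta,\zeta)$. Put $\kappa_k=\frac{2k+1}{2}$ and $$\gamma_{a,k}(\xi)=\int_{\mathbb{R}_+}a\left(\frac{v}{2\xi}\right)\ell_k^2(v)\,\mathrm{d}v,\qquad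 \xi>0.$$ Then $K^{(k)}_\zeta(\zeta)=\kappa_k$ for every $\zeta\in G$, the integral defining $\gamma_{a,k}(\xi)$ and the integrals below converge absolutely, the Wick symbol $\widetilde a_k(\zeta)$, $\zeta=(u,v)$, depends only on $v$, and $$\widetilde a_k(v)=2\,\kappa_k^{-1}v^2\int_{\mathbb{R}_+}\gamma_{a,k}(\xi)\,\ell_k^2(2v\xi)\,\xi\,\mathrm{d}\xi,\qquad v>0.$$ Moreover, for all $\zeta=(u,v)$ and $\eta=(s,t)$ in $G$ with $K^{(k)}_\zeta(\eta)\neq0$, $$\widetilde a_k(\zeta,\eta)=\frac{2tv}{K^{(k)}_\zeta(\eta)}\int_{\mathbb{R}_+}\gamma_{a,k}(\xi)\,\ell_k(2v\xi)\,\ell_k(2t\xi)\,\mathrm{e}^{-2\pi\mathrm{i}\xi(u-s)}\,\xi\,\mathrm{d}\xi.$$ -/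

import Mathlib

open MeasureTheory Set
open scoped FourierTransform SchwartzMap ENNReal InnerProductSpace ComplexConjugate

noncomputable section

namespace CalderonToeplitz

/-- Points `ζ = (u, v)`, `v > 0`, of the affine group (the upper half-plane). -/
abbrev G : Type := {ζ : ℝ × ℝ // 0 < ζ.2}

/-- The left Haar measure `v⁻² du dv` of the affine group, as a measure on `ℝ × ℝ` that is
concentrated on the upper half-plane. -/
def nu : Measure (ℝ × ℝ) :=
  (volume : Measure ℝ).prod
    (((volume : Measure ℝ).restrict (Ioi 0)).withDensity fun v => ENNReal.ofReal (v ^ 2)⁻¹)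

/-- The Laguerre polynomial of degree `k` and type `0`. -/
def laguerrePoly (k : ℕ) (y : ℝ) : ℝ :=
  ∑ i ∈ Finset.range (k + 1), (-1) ^ i * (k.choose (k - i) : ℝ) * (y ^ i / (i.factorial : ℝ))

/-- The Laguerre function `ℓ_k(y) = e^{-y/2} L_k(y)`. -/
def laguerreFun (k : ℕ) (y : ℝ) : ℝ := Real.exp (-y / 2) * laguerrePoly k y

/-- The Fourier transform of the wavelet: `χ_+(ξ) √(2ξ) ℓ_k(2ξ)`. -/
def psiHat (k : ℕ) (ξ : ℝ) : ℂ :=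
  (Ioi (0 : ℝ)).indicator (fun ξ => ((√(2 * ξ) * laguerreFun k (2 * ξ) : ℝ) : ℂ)) ξ

/-- The wavelet `ψ^{(k)}`, the inverse Fourier transform of the integrable function `psiHat k`. -/
def psi (k : ℕ) : ℝ → ℂ := 𝓕⁻ (psiHat k)

/-- The quasi-regular representation `(ρ_{(u,v)} f)(x) = v^{-1/2} f((x-u)/v)`. -/
def rho (ζ : ℝ × ℝ) (f : ℝ → ℂ) (x : ℝ) : ℂ := ((1 / √ζ.2 : ℝ) : ℂ) * f ((x - ζ.1) / ζ.2)

/-- The Hardy space of all `h ∈ L₂(ℝ)` whose Fourier transform is supported in `[0, ∞)`. -/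
def hardy : Submodule ℂ (Lp ℂ 2 (volume : Measure ℝ)) where
  carrier := {h | ∀ᵐ ξ : ℝ, ξ < 0 → (𝓕 h : Lp ℂ 2 (volume : Measure ℝ)) ξ = 0}
  add_mem' {f g} hf hg := by
    simp only [mem_ofPred_eq] at hf hg ⊢
    rw [FourierTransform.fourier_add]
    filter_upwards [hf, hg, Lp.coeFn_add (𝓕 f) (𝓕 g)] with ξ h1 h2 h3 h
    rw [h3, Pi.add_apply, h1 h, h2 h, add_zero]
  zero_mem' := by
    simp only [mem_ofPred_eq]
    have h0 : 𝓕 (0 : Lp ℂ 2 (volume : Measure ℝ)) = 0 :=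
      (Lp.fourierTransformₗᵢ ℝ ℂ).map_zero
    rw [h0]
    filter_upwards [Lp.coeFn_zero ℂ 2 (volume : Measure ℝ)] with ξ h1 _
    rw [h1, Pi.zero_apply]
  smul_mem' c f hf := by
    simp only [mem_ofPred_eq] at hf ⊢
    rw [FourierTransform.fourier_smul]
    filter_upwards [hf, Lp.coeFn_smul c (𝓕 f)] with ξ h1 h3 h
    rw [h3, Pi.smul_apply, h1 h, smul_zero]

/-- The continuous wavelet transform `(W_k f)(u, v) = (f * ψ_v)(u)`, where
`ψ_v(x) = v^{-1/2} ψ^{(k)}(x/v)`. -/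
def waveletFun (k : ℕ) (f : ℝ → ℂ) (ζ : ℝ × ℝ) : ℂ :=
  convolution f (rho (0, ζ.2) (psi k)) (ContinuousLinearMap.mul ℂ ℂ) volume ζ.1

/-! Square integrability of the objects above. -/
theorem continuous_fourierInv_of_integrable {g : ℝ → ℂ} (h1 : Integrable g) :
    Continuous (𝓕⁻ g : ℝ → ℂ) := by
  have h : Continuous fun p : ℝ × ℝ => (-innerₗ ℝ : ℝ →ₗ[ℝ] ℝ →ₗ[ℝ] ℝ) p.1 p.2 := by
    simp only [LinearMap.neg_apply, innerₗ_apply_apply]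
    exact continuous_inner.neg
  exact VectorFourier.fourierIntegral_continuous (μ := (volume : Measure ℝ))
    Real.continuous_fourierChar h h1

theorem integral_fourierInv_mul_swap {f g : ℝ → ℂ} (hf : Integrable f) (hg : Integrable g) :
    ∫ x, (𝓕⁻ f) x * g x = ∫ x, f x * (𝓕⁻ g) x := by
  have h : Continuous fun p : ℝ × ℝ => (-innerₗ ℝ : ℝ →ₗ[ℝ] ℝ →ₗ[ℝ] ℝ) p.1 p.2 := by
    simp only [LinearMap.neg_apply, innerₗ_apply_apply]
    exact continuous_inner.neg
  have h2 : (-innerₗ ℝ : ℝ →ₗ[ℝ] ℝ →ₗ[ℝ] ℝ).flip = -innerₗ ℝ := by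
    ext; simp
  have := VectorFourier.integral_fourierIntegral_smul_eq_flip (e := Real.fourierChar)
      (μ := (volume : Measure ℝ)) (ν := (volume : Measure ℝ)) (L := -innerₗ ℝ) (f := f) (g := g)
      Real.continuous_fourierChar h hf hg
  rw [h2] at this
  exact this

theorem fourierInv_toLp_ae {g : ℝ → ℂ} (h1 : Integrable g) (h2 : MemLp g 2) :
    ((𝓕⁻ (h2.toLp g) : Lp ℂ 2 (volume : Measure ℝ)) : ℝ → ℂ) =ᵐ[volume] 𝓕⁻ g := by
  refine ae_eq_of_integral_contDiff_smul_eq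
    ((Lp.memLp _).locallyIntegrable (by norm_num))
    (continuous_fourierInv_of_integrable h1).locallyIntegrable ?_
  intro φ hφ hφc
  have hφ' : ContDiff ℝ (⊤ : ℕ∞) (fun x => (φ x : ℂ)) := Complex.ofRealCLM.contDiff.comp hφ
  have hφc' : HasCompactSupport (fun x => (φ x : ℂ)) :=
    hφc.comp_left (g := fun y : ℝ => (y : ℂ)) (by simp)
  obtain ⟨Φ, hΦ⟩ : ∃ Φ : 𝓢(ℝ, ℂ), ∀ x, Φ x = (φ x : ℂ) :=
    ⟨hφc'.toSchwartzMap hφ', fun x => rfl⟩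
  have key := congrArg (fun T => T Φ) (Lp.fourierInv_toTemperedDistribution_eq (h2.toLp g))
  simp only [TemperedDistribution.fourierInv_apply, Lp.toTemperedDistribution_apply] at key
  have e1 : ∫ x, (𝓕⁻ Φ) x • (h2.toLp g) x = ∫ x, (𝓕⁻ (Φ : ℝ → ℂ)) x * g x := by
    refine integral_congr_ae ?_
    filter_upwards [h2.coeFn_toLp] with x hx
    rw [hx, SchwartzMap.fourierInv_coe, smul_eq_mul]
  rw [e1, integral_fourierInv_mul_swap Φ.integrable h1] at key
  simp only [hΦ, smul_eq_mul] at key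
  simp only [Complex.real_smul]
  exact key.symm
theorem abs_laguerreFun_le (k : ℕ) :
    ∃ C : ℝ, 0 ≤ C ∧ ∀ y, 0 ≤ y → |laguerreFun k y| ≤ C * Real.exp (-y / 4) := by
  refine ⟨∑ i ∈ Finset.range (k + 1), (k.choose (k - i) : ℝ) * 4 ^ i, by positivity, ?_⟩
  intro y hy
  have h1 : |laguerrePoly k y| ≤
      (∑ i ∈ Finset.range (k + 1), (k.choose (k - i) : ℝ) * 4 ^ i) * Real.exp (y / 4) := by
    unfold laguerrePoly
    refine (Finset.abs_sum_le_sum_abs _ _).trans ?_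
    rw [Finset.sum_mul]
    refine Finset.sum_le_sum fun i _ => ?_
    have h := Real.pow_div_factorial_le_exp (y / 4) (by positivity) i
    rw [abs_mul, abs_mul, abs_pow, abs_neg, abs_one, one_pow, one_mul, Nat.abs_cast,
      abs_of_nonneg (by positivity : 0 ≤ y ^ i / (i.factorial : ℝ)), mul_assoc]
    refine mul_le_mul_of_nonneg_left ?_ (by positivity)
    calc y ^ i / (i.factorial : ℝ) = 4 ^ i * ((y / 4) ^ i / (i.factorial : ℝ)) := by
          rw [div_pow]; field_simp
      _ ≤ _ := mul_le_mul_of_nonneg_left h (by positivity)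
  unfold laguerreFun
  rw [abs_mul, Real.abs_exp]
  calc Real.exp (-y / 2) * |laguerrePoly k y|
      ≤ Real.exp (-y / 2) *
        ((∑ i ∈ Finset.range (k + 1), (k.choose (k - i) : ℝ) * 4 ^ i) * Real.exp (y / 4)) :=
        mul_le_mul_of_nonneg_left h1 (Real.exp_nonneg _)
    _ = (∑ i ∈ Finset.range (k + 1), (k.choose (k - i) : ℝ) * 4 ^ i) *
        (Real.exp (-y / 2) * Real.exp (y / 4)) := by ring
    _ = _ := by rw [← Real.exp_add]; ring_nf

theorem continuous_laguerreFun (k : ℕ) : Continuous (laguerreFun k) := by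
  unfold laguerreFun laguerrePoly
  fun_prop

theorem measurable_psiHat (k : ℕ) : Measurable (psiHat k) := by
  have h := continuous_laguerreFun k
  refine Measurable.indicator ?_ measurableSet_Ioi
  exact Complex.measurable_ofReal.comp (by fun_prop)

theorem norm_psiHat_le (k : ℕ) : ∃ C : ℝ, 0 ≤ C ∧ ∀ ξ, ‖psiHat k ξ‖ ≤
    (Ioi (0 : ℝ)).indicator (fun ξ => C * Real.exp (-(1 / 4) * ξ)) ξ := by
  obtain ⟨C, hC, h⟩ := abs_laguerreFun_le k
  refine ⟨2 * C, by positivity, fun ξ => ?_⟩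
  unfold psiHat
  by_cases hξ : ξ ∈ Ioi (0 : ℝ)
  · rw [indicator_of_mem hξ, indicator_of_mem hξ, Complex.norm_real, Real.norm_eq_abs, abs_mul,
      abs_of_nonneg (Real.sqrt_nonneg _)]
    have h0 : (0 : ℝ) < ξ := hξ
    have h1 : √(2 * ξ) ≤ 2 * Real.exp (ξ / 4) := by
      rw [Real.sqrt_le_left (by positivity), mul_pow, ← Real.exp_nat_mul]
      have := Real.add_one_le_exp (((2 : ℕ) : ℝ) * (ξ / 4))
      push_cast at this ⊢
      linarith
    calc √(2 * ξ) * |laguerreFun k (2 * ξ)|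
        ≤ (2 * Real.exp (ξ / 4)) * (C * Real.exp (-(2 * ξ) / 4)) :=
          mul_le_mul h1 (h _ (by positivity)) (abs_nonneg _) (by positivity)
      _ = 2 * C * (Real.exp (ξ / 4) * Real.exp (-(2 * ξ) / 4)) := by ring
      _ = _ := by rw [← Real.exp_add]; ring_nf
  · rw [indicator_of_notMem hξ, indicator_of_notMem hξ, norm_zero]

theorem memLp_one_psiHat (k : ℕ) : MemLp (psiHat k) 1 := by
  obtain ⟨C, hC, h⟩ := norm_psiHat_le k
  rw [memLp_one_iff_integrable]
  refine Integrable.mono' ?_ (measurable_psiHat k).aestronglyMeasurable (.of_forall h)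
  rw [integrable_indicator_iff measurableSet_Ioi]
  exact ((integrableOn_exp_mul_Ioi (by norm_num) 0).const_mul C)

theorem memLp_top_psiHat (k : ℕ) : MemLp (psiHat k) ∞ := by
  obtain ⟨C, hC, h⟩ := norm_psiHat_le k
  refine memLp_top_of_bound (measurable_psiHat k).aestronglyMeasurable C (.of_forall fun ξ => ?_)
  refine (h ξ).trans ?_
  by_cases hξ : ξ ∈ Ioi (0 : ℝ)
  · have h0 : (0 : ℝ) < ξ := hξ
    rw [indicator_of_mem hξ]
    exact mul_le_of_le_one_right hC (Real.exp_le_one_iff.2 (by linarith))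
  · rwa [indicator_of_notMem hξ]

/-- The Fourier transform of `ρ_{(u,v)} ψ^{(k)}`. -/
def rhoPsiHat (k : ℕ) (ζ : ℝ × ℝ) (ξ : ℝ) : ℂ :=
  ((√ζ.2 : ℝ) : ℂ) * Complex.exp (((-2 * Real.pi * (ξ * ζ.1) : ℝ) : ℂ) * Complex.I) *
    psiHat k (ζ.2 * ξ)

theorem measurable_rhoPsiHat (k : ℕ) (ζ : ℝ × ℝ) : Measurable (rhoPsiHat k ζ) := by
  have h := measurable_psiHat k
  unfold rhoPsiHat
  fun_prop

theorem norm_rhoPsiHat (k : ℕ) (ζ : ℝ × ℝ) (ξ : ℝ) :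
    ‖rhoPsiHat k ζ ξ‖ = √ζ.2 * ‖psiHat k (ζ.2 * ξ)‖ := by
  unfold rhoPsiHat
  rw [norm_mul, norm_mul, Complex.norm_exp_ofReal_mul_I, mul_one, Complex.norm_real,
    Real.norm_of_nonneg (Real.sqrt_nonneg _)]

theorem memLp_one_rhoPsiHat (k : ℕ) {ζ : ℝ × ℝ} (hζ : 0 < ζ.2) : MemLp (rhoPsiHat k ζ) 1 := by
  have h := memLp_one_psiHat k
  rw [memLp_one_iff_integrable] at h ⊢
  refine Integrable.mono' (((h.comp_mul_left' hζ.ne').norm).const_mul √ζ.2)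
    (measurable_rhoPsiHat k ζ).aestronglyMeasurable (.of_forall fun ξ => ?_)
  exact (norm_rhoPsiHat k ζ ξ).le

theorem memLp_top_rhoPsiHat (k : ℕ) (ζ : ℝ × ℝ) : MemLp (rhoPsiHat k ζ) ∞ := by
  obtain ⟨C, hC, h⟩ := norm_psiHat_le k
  refine memLp_top_of_bound (measurable_rhoPsiHat k ζ).aestronglyMeasurable (√ζ.2 * C)
    (.of_forall fun ξ => ?_)
  rw [norm_rhoPsiHat]
  refine mul_le_mul_of_nonneg_left ((h _).trans ?_) (Real.sqrt_nonneg _)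
  by_cases hξ : ζ.2 * ξ ∈ Ioi (0 : ℝ)
  · have h0 : (0 : ℝ) < ζ.2 * ξ := hξ
    rw [indicator_of_mem hξ]
    exact mul_le_of_le_one_right hC (Real.exp_le_one_iff.2 (by linarith))
  · rwa [indicator_of_notMem hξ]

theorem memLp_two_rhoPsiHat (k : ℕ) {ζ : ℝ × ℝ} (hζ : 0 < ζ.2) : MemLp (rhoPsiHat k ζ) 2 := by
  obtain ⟨C, hC, h⟩ := norm_psiHat_le k
  have h1 := memLp_one_rhoPsiHat k hζ
  have ht := memLp_top_rhoPsiHat k ζ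
  rw [memLp_two_iff_integrable_sq_norm h1.1]
  have h1' := (memLp_one_iff_integrable.1 h1).norm
  have := h1'.mul_of_top_right ht.norm
  refine this.congr (.of_forall fun ξ => ?_)
  simp [sq]

theorem rho_psi_eq (k : ℕ) {ζ : ℝ × ℝ} (hζ : 0 < ζ.2) : rho ζ (psi k) = 𝓕⁻ (rhoPsiHat k ζ) := by
  ext x
  have hs : √ζ.2 * √ζ.2 = ζ.2 := Real.mul_self_sqrt hζ.le
  have hs0 : 0 < √ζ.2 := Real.sqrt_pos.2 hζ
  have hcv := Measure.integral_comp_mul_left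
    (fun ξ => Complex.exp (((2 * Real.pi * (ξ * ((x - ζ.1) / ζ.2)) : ℝ) : ℂ) * Complex.I) *
      psiHat k ξ) ζ.2
  rw [rho, psi, Real.fourierInv_eq', Real.fourierInv_eq']
  have e : ∀ ξ : ℝ, Complex.exp (((2 * Real.pi * ⟪ξ, x⟫_ℝ : ℝ) : ℂ) * Complex.I) • rhoPsiHat k ζ ξ
      = ((√ζ.2 : ℝ) : ℂ) * (Complex.exp
        (((2 * Real.pi * (ζ.2 * ξ * ((x - ζ.1) / ζ.2)) : ℝ) : ℂ) * Complex.I) *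
        psiHat k (ζ.2 * ξ)) := by
    intro ξ
    have e1 : ((2 * Real.pi * (ζ.2 * ξ * ((x - ζ.1) / ζ.2)) : ℝ) : ℂ) * Complex.I =
        ((2 * Real.pi * ⟪ξ, x⟫_ℝ : ℝ) : ℂ) * Complex.I +
        ((-2 * Real.pi * (ξ * ζ.1) : ℝ) : ℂ) * Complex.I := by
      rw [← add_mul, ← Complex.ofReal_add]
      congr 2
      simp only [RCLike.inner_apply, conj_trivial]
      field_simp
      ring
    rw [e1, Complex.exp_add, rhoPsiHat, smul_eq_mul]
    ring
  simp only [e]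
  rw [integral_const_mul, hcv]
  have e2 : ∀ ξ : ℝ, Complex.exp (((2 * Real.pi * ⟪ξ, (x - ζ.1) / ζ.2⟫_ℝ : ℝ) : ℂ) * Complex.I)
      • psiHat k ξ = Complex.exp
        (((2 * Real.pi * (ξ * ((x - ζ.1) / ζ.2)) : ℝ) : ℂ) * Complex.I) * psiHat k ξ := by
    intro ξ
    simp only [RCLike.inner_apply, conj_trivial, smul_eq_mul, mul_comm ξ]
  simp only [e2]
  rw [abs_of_pos (inv_pos.2 hζ), Complex.real_smul, ← mul_assoc, ← Complex.ofReal_mul]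
  congr 2
  nth_rewrite 3 [← hs]
  field_simp

theorem memLp_rho_psi (k : ℕ) (ζ : G) : MemLp (rho ζ.1 (psi k)) 2 := by
  rw [rho_psi_eq k ζ.2]
  exact (memLp_congr_ae (fourierInv_toLp_ae (memLp_one_iff_integrable.1 (memLp_one_rhoPsiHat k ζ.2))
    (memLp_two_rhoPsiHat k ζ.2))).1 (Lp.memLp _)

/-- The function `ρ_ζ ψ^{(k)}` as an element of `L₂(ℝ)`. -/
def rhoPsi (k : ℕ) (ζ : G) : Lp ℂ 2 (volume : Measure ℝ) := (memLp_rho_psi k ζ).toLp _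

theorem fourier_rhoPsi (k : ℕ) (ζ : G) :
    𝓕 (rhoPsi k ζ) = (memLp_two_rhoPsiHat k ζ.2).toLp (rhoPsiHat k ζ.1) := by
  have h : rhoPsi k ζ = 𝓕⁻ ((memLp_two_rhoPsiHat k ζ.2).toLp (rhoPsiHat k ζ.1)) := by
    refine Lp.ext ((MemLp.coeFn_toLp _).trans ?_)
    rw [rho_psi_eq k ζ.2]
    exact (fourierInv_toLp_ae (memLp_one_iff_integrable.1 (memLp_one_rhoPsiHat k ζ.2))
      (memLp_two_rhoPsiHat k ζ.2)).symm
  rw [h, FourierTransform.fourier_fourierInv_eq]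

theorem rhoPsi_mem_hardy (k : ℕ) (ζ : G) : rhoPsi k ζ ∈ hardy := by
  change ∀ᵐ ξ : ℝ, ξ < 0 → (𝓕 (rhoPsi k ζ) : Lp ℂ 2 (volume : Measure ℝ)) ξ = 0
  rw [fourier_rhoPsi]
  filter_upwards [(memLp_two_rhoPsiHat k ζ.2).coeFn_toLp] with ξ h1 h
  rw [h1, rhoPsiHat, psiHat, indicator_of_notMem, mul_zero]
  exact notMem_Ioi.2 (mul_nonpos_of_nonneg_of_nonpos ζ.2.le h.le)

theorem psi_neg (k : ℕ) (x : ℝ) : psi k (-x) = conj (psi k x) := by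
  rw [psi, Real.fourierInv_eq', Real.fourierInv_eq', ← integral_conj]
  refine integral_congr_ae (.of_forall fun ξ => ?_)
  have : conj (psiHat k ξ) = psiHat k ξ := by
    unfold psiHat
    by_cases hξ : ξ ∈ Ioi (0 : ℝ)
    · rw [indicator_of_mem hξ, Complex.conj_ofReal]
    · rw [indicator_of_notMem hξ, map_zero]
  simp only [smul_eq_mul, map_mul, this, ← Complex.exp_conj, Complex.conj_ofReal, Complex.conj_I]
  simp

theorem waveletFun_eq_inner (k : ℕ) (f : Lp ℂ 2 (volume : Measure ℝ)) (ζ : G) :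
    waveletFun k f ζ.1 = ⟪rhoPsi k ζ, f⟫_ℂ := by
  rw [L2.inner_def, waveletFun, convolution_def]
  refine integral_congr_ae ?_
  filter_upwards [(memLp_rho_psi k ζ).coeFn_toLp] with t ht
  rw [rhoPsi, ht, RCLike.inner_apply, ContinuousLinearMap.mul_apply']
  congr 1
  simp only [rho, map_mul, Complex.conj_ofReal, ← psi_neg]
  congr 2
  ring

theorem waveletFun_eq_fourierInv (k : ℕ) (f : Lp ℂ 2 (volume : Measure ℝ)) (ζ : G) :
    waveletFun k f ζ.1 = (𝓕⁻ fun ξ : ℝ => rhoPsiHat k (0, ζ.1.2) ξ *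
      (𝓕 f : Lp ℂ 2 (volume : Measure ℝ)) ξ) ζ.1.1 := by
  rw [waveletFun_eq_inner, ← Lp.inner_fourier_eq, fourier_rhoPsi, L2.inner_def,
    Real.fourierInv_eq']
  refine integral_congr_ae ?_
  filter_upwards [(memLp_two_rhoPsiHat k ζ.2).coeFn_toLp] with ξ h1
  have : conj (psiHat k (ζ.1.2 * ξ)) = psiHat k (ζ.1.2 * ξ) := by
    unfold psiHat
    by_cases hξ : ζ.1.2 * ξ ∈ Ioi (0 : ℝ)
    · rw [indicator_of_mem hξ, Complex.conj_ofReal]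
    · rw [indicator_of_notMem hξ, map_zero]
  rw [h1, RCLike.inner_apply]
  simp only [rhoPsiHat, map_mul, this, ← Complex.exp_conj, Complex.conj_ofReal, Complex.conj_I,
    smul_eq_mul, RCLike.inner_apply, conj_trivial]
  simp only [mul_zero, Complex.ofReal_zero, zero_mul, Complex.exp_zero, mul_one]
  have e : ((-2 * Real.pi * (ξ * ζ.1.1) : ℝ) : ℂ) * -Complex.I =
      ((2 * Real.pi * (ζ.1.1 * ξ) : ℝ) : ℂ) * Complex.I := by push_cast; ring
  rw [e]
  ring

theorem lintegral_sq_fourierInv {g : ℝ → ℂ} (h1 : Integrable g) (h2 : MemLp g 2) :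
    ∫⁻ x, ‖(𝓕⁻ g) x‖ₑ ^ (2 : ℝ) = ∫⁻ x, ‖g x‖ₑ ^ (2 : ℝ) := by
  have e := (Lp.fourierTransformₗᵢ ℝ ℂ).symm.norm_map (h2.toLp g)
  have e' : ‖(𝓕⁻ (h2.toLp g) : Lp ℂ 2 (volume : Measure ℝ))‖ = ‖h2.toLp g‖ := e
  have e2 : eLpNorm (𝓕⁻ g) 2 volume = eLpNorm g 2 volume := by
    rw [← eLpNorm_congr_ae (fourierInv_toLp_ae h1 h2), ← eLpNorm_congr_ae h2.coeFn_toLp,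
      ← Lp.enorm_def, ← Lp.enorm_def, ← ofReal_norm, ← ofReal_norm, e']
  rw [eLpNorm_eq_lintegral_rpow_enorm_toReal (by norm_num) (by norm_num),
    eLpNorm_eq_lintegral_rpow_enorm_toReal (by norm_num) (by norm_num)] at e2
  simpa using ENNReal.rpow_left_injective (x := (1 / (2 : ℝ≥0∞).toReal)) (by norm_num) e2

theorem lintegral_waveletFun_slice (k : ℕ) (f : Lp ℂ 2 (volume : Measure ℝ)) {v : ℝ}
    (hv : 0 < v) :
    ∫⁻ u, ‖waveletFun k f (u, v)‖ₑ ^ (2 : ℝ) =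
      ∫⁻ ξ, ENNReal.ofReal v * ‖psiHat k (v * ξ)‖ₑ ^ (2 : ℝ) *
        ‖(𝓕 f : Lp ℂ 2 (volume : Measure ℝ)) ξ‖ₑ ^ (2 : ℝ) := by
  have hf : MemLp (𝓕 f : Lp ℂ 2 (volume : Measure ℝ)) 2 volume := Lp.memLp _
  have g1 : Integrable fun ξ : ℝ => rhoPsiHat k (0, v) ξ *
      (𝓕 f : Lp ℂ 2 (volume : Measure ℝ)) ξ :=
    (memLp_two_rhoPsiHat k (ζ := (0, v)) hv).integrable_mul hf
  have g2 : MemLp (fun ξ : ℝ => rhoPsiHat k (0, v) ξ *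
      (𝓕 f : Lp ℂ 2 (volume : Measure ℝ)) ξ) 2 :=
    hf.mul (memLp_top_rhoPsiHat k (0, v))
  have h := lintegral_sq_fourierInv g1 g2
  have e : ∀ u : ℝ, waveletFun k f (u, v) = (𝓕⁻ fun ξ : ℝ => rhoPsiHat k (0, v) ξ *
      (𝓕 f : Lp ℂ 2 (volume : Measure ℝ)) ξ) u :=
    fun u => waveletFun_eq_fourierInv k f ⟨(u, v), hv⟩
  simp only [e, h]
  refine lintegral_congr fun ξ => ?_
  rw [enorm_mul, ENNReal.mul_rpow_of_nonneg _ _ (by norm_num)]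
  congr 1
  rw [← ofReal_norm, norm_rhoPsiHat, ENNReal.ofReal_mul (Real.sqrt_nonneg _),
    ENNReal.mul_rpow_of_nonneg _ _ (by norm_num), ofReal_norm]
  congr 1
  rw [ENNReal.ofReal_rpow_of_nonneg (Real.sqrt_nonneg _) (by norm_num), Real.rpow_two,
    Real.sq_sqrt hv.le]

theorem ae_nu_pos : ∀ᵐ ζ ∂nu, 0 < ζ.2 := by
  have h1 : ∀ᵐ v ∂(((volume : Measure ℝ).restrict (Ioi 0)).withDensity
      fun v => ENNReal.ofReal (v ^ 2)⁻¹), 0 < v :=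
    (withDensity_absolutelyContinuous _ _).ae_le (ae_restrict_mem measurableSet_Ioi)
  exact Measure.quasiMeasurePreserving_snd.ae h1

theorem aestronglyMeasurable_waveletFun (k : ℕ) (f : Lp ℂ 2 (volume : Measure ℝ)) :
    AEStronglyMeasurable (waveletFun k f) nu := by
  have hf : Measurable (𝓕 f : Lp ℂ 2 (volume : Measure ℝ)) := (Lp.stronglyMeasurable _).measurable
  have hp := measurable_psiHat k
  have hm : StronglyMeasurable fun p : (ℝ × ℝ) × ℝ =>
      Complex.exp (((2 * Real.pi * (p.1.1 * p.2) : ℝ) : ℂ) * Complex.I) *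
      (rhoPsiHat k (0, p.1.2) p.2 * (𝓕 f : Lp ℂ 2 (volume : Measure ℝ)) p.2) := by
    refine Measurable.stronglyMeasurable ?_
    unfold rhoPsiHat
    fun_prop
  refine (hm.integral_prod_right' (ν := volume)).aestronglyMeasurable.congr ?_
  filter_upwards [ae_nu_pos] with ζ hζ
  rw [waveletFun_eq_fourierInv k f ⟨ζ, hζ⟩, Real.fourierInv_eq']
  simp only [RCLike.inner_apply, conj_trivial, smul_eq_mul]

/-- The admissibility integral `∫_0^∞ |ψ̂^{(k)}(w)|² dw / w`. -/
def admConst (k : ℕ) : ℝ≥0∞ := ∫⁻ w, ‖psiHat k w‖ₑ ^ (2 : ℝ) * ENNReal.ofReal w⁻¹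

theorem admConst_scale (k : ℕ) {ξ : ℝ} (hξ : 0 < ξ) :
    ∫⁻ v, ‖psiHat k (v * ξ)‖ₑ ^ (2 : ℝ) * ENNReal.ofReal v⁻¹ = admConst k := by
  have hp := measurable_psiHat k
  rw [admConst]
  nth_rewrite 2 [← Real.smul_map_volume_mul_left hξ.ne']
  rw [lintegral_smul_measure, lintegral_map (by fun_prop) (by fun_prop), smul_eq_mul,
    ← lintegral_const_mul' _ _ ENNReal.ofReal_ne_top]
  refine lintegral_congr fun v => ?_
  rw [mul_comm ξ v, mul_left_comm, ← ENNReal.ofReal_mul (abs_nonneg _), abs_of_pos hξ, mul_inv,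
    mul_comm v⁻¹, mul_inv_cancel_left₀ hξ.ne']

theorem admConst_ne_top (k : ℕ) : admConst k ≠ ∞ := by
  obtain ⟨C, hC, h⟩ := abs_laguerreFun_le k
  have hi : IntegrableOn (fun w : ℝ => 2 * C ^ 2 * Real.exp (-1 * w)) (Ioi 0) :=
    (integrableOn_exp_mul_Ioi (by norm_num) 0).const_mul _
  have hi2 := hi.integrable_indicator measurableSet_Ioi
  refine ne_top_of_le_ne_top hi2.lintegral_lt_top.ne (lintegral_mono fun w => ?_)
  by_cases hw : w ∈ Ioi (0 : ℝ)
  · have h0 : (0 : ℝ) < w := hw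
    rw [indicator_of_mem hw, psiHat, indicator_of_mem hw, ← ofReal_norm,
      ENNReal.ofReal_rpow_of_nonneg (norm_nonneg _) (by norm_num),
      ← ENNReal.ofReal_mul (by positivity)]
    refine ENNReal.ofReal_le_ofReal ?_
    rw [Complex.norm_real, Real.rpow_two, Real.norm_eq_abs, sq_abs, mul_pow,
      Real.sq_sqrt (by positivity)]
    have h1 := h (2 * w) (by positivity)
    have h2 : laguerreFun k (2 * w) ^ 2 ≤ (C * Real.exp (-(2 * w) / 4)) ^ 2 := sq_le_sq' 
      (by linarith [neg_abs_le (laguerreFun k (2 * w))]) ((le_abs_self _).trans h1)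
    rw [mul_pow, ← Real.exp_nat_mul] at h2
    have e : ((2 : ℕ) : ℝ) * (-(2 * w) / 4) = -1 * w := by push_cast; ring
    rw [e] at h2
    calc 2 * w * laguerreFun k (2 * w) ^ 2 * w⁻¹ = 2 * laguerreFun k (2 * w) ^ 2 := by
          field_simp
      _ ≤ _ := by linarith
  · rw [psiHat, indicator_of_notMem hw]
    simp

theorem admConst_ne_zero (k : ℕ) : admConst k ≠ 0 := by
  have hp := measurable_psiHat k
  intro h
  rw [admConst, lintegral_eq_zero_iff (by fun_prop)] at h
  have h0 : laguerreFun k (2 * 0) ≠ 0 := by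
    have : laguerrePoly k 0 = 1 := by
      rw [laguerrePoly, Finset.sum_eq_single 0]
      · simp
      · intro i _ hi
        simp [hi]
      · simp
    rw [laguerreFun, mul_zero, this]
    positivity
  have hc : Continuous fun w => laguerreFun k (2 * w) :=
    (continuous_laguerreFun k).comp (by fun_prop)
  have h1 : ∀ᶠ w in nhds (0 : ℝ), laguerreFun k (2 * w) ≠ 0 := hc.continuousAt.eventually_ne h0
  obtain ⟨ε, hε, h2⟩ := Metric.eventually_nhds_iff.1 h1
  have h3 : (volume : Measure ℝ) (Ioo 0 ε) = 0 := by
    refine measure_mono_null (fun w hw => ?_) h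
    have hw0 : w ∈ Ioi (0 : ℝ) := hw.1
    have hw' : (0 : ℝ) < w := hw0
    have h4 := h2 (y := w) (by rw [Real.dist_eq, sub_zero, abs_of_pos hw']; exact hw.2)
    have h5 : psiHat k w ≠ 0 := by
      rw [psiHat, indicator_of_mem hw0]
      exact_mod_cast mul_ne_zero (Real.sqrt_pos.2 (by positivity)).ne' h4
    change ¬ (_ = _)
    simp [h5, hw']
  rw [Real.volume_Ioo, ENNReal.ofReal_eq_zero] at h3
  linarith

theorem lintegral_waveletFun (k : ℕ) (f : hardy) :
    ∫⁻ ζ, ‖waveletFun k f.1 ζ‖ₑ ^ (2 : ℝ) ∂nu =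
      admConst k * ∫⁻ ξ, ‖(f.1 : Lp ℂ 2 (volume : Measure ℝ)) ξ‖ₑ ^ (2 : ℝ) := by
  have hp := measurable_psiHat k
  have hfm : Measurable (𝓕 f.1 : Lp ℂ 2 (volume : Measure ℝ)) :=
    (Lp.stronglyMeasurable _).measurable
  have hF : ∫⁻ ξ, ‖(𝓕 f.1 : Lp ℂ 2 (volume : Measure ℝ)) ξ‖ₑ ^ (2 : ℝ) =
      ∫⁻ ξ, ‖(f.1 : Lp ℂ 2 (volume : Measure ℝ)) ξ‖ₑ ^ (2 : ℝ) := by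
    have e := Lp.norm_fourier_eq f.1
    have e2 : eLpNorm (𝓕 f.1 : Lp ℂ 2 (volume : Measure ℝ)) 2 volume =
        eLpNorm (f.1 : Lp ℂ 2 (volume : Measure ℝ)) 2 volume := by
      rw [← Lp.enorm_def, ← Lp.enorm_def, ← ofReal_norm, ← ofReal_norm, e]
    rw [eLpNorm_eq_lintegral_rpow_enorm_toReal (by norm_num) (by norm_num),
      eLpNorm_eq_lintegral_rpow_enorm_toReal (by norm_num) (by norm_num)] at e2
    simpa using ENNReal.rpow_left_injective (x := (1 / (2 : ℝ≥0∞).toReal)) (by norm_num) e2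
  have hm := (aestronglyMeasurable_waveletFun k f.1).enorm.pow_const (2 : ℝ)
  rw [← hF, nu, lintegral_prod_symm _ hm, 
    lintegral_withDensity_eq_lintegral_mul_non_measurable _ (by fun_prop)
      (.of_forall fun _ => ENNReal.ofReal_lt_top)]
  have s1 : ∀ v ∈ Ioi (0 : ℝ), ((fun v : ℝ => ENNReal.ofReal (v ^ 2)⁻¹) *
      fun v => ∫⁻ u, ‖waveletFun k f.1 (u, v)‖ₑ ^ (2 : ℝ)) v =
      ∫⁻ ξ, ‖psiHat k (v * ξ)‖ₑ ^ (2 : ℝ) * ENNReal.ofReal v⁻¹ *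
        ‖(𝓕 f.1 : Lp ℂ 2 (volume : Measure ℝ)) ξ‖ₑ ^ (2 : ℝ) := by
    intro v hv
    have hv' : (0 : ℝ) < v := hv
    rw [Pi.mul_apply, lintegral_waveletFun_slice k f.1 hv',
      ← lintegral_const_mul' _ _ ENNReal.ofReal_ne_top]
    refine lintegral_congr fun ξ => ?_
    rw [← mul_assoc, ← mul_assoc, ← ENNReal.ofReal_mul (by positivity), mul_comm (_ ^ (2 : ℝ))]
    congr 3
    field_simp
  rw [setLIntegral_congr_fun measurableSet_Ioi s1, lintegral_lintegral_swap (by fun_prop),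
    ← lintegral_const_mul' _ _ (admConst_ne_top k)]
  refine lintegral_congr_ae ?_
  have h0 : ∀ᵐ ξ : ℝ, ξ ≠ 0 := by simp [ae_iff]
  have hneg : ∀ᵐ ξ : ℝ, ξ < 0 → (𝓕 f.1 : Lp ℂ 2 (volume : Measure ℝ)) ξ = 0 := f.2
  filter_upwards [h0, hneg] with ξ h0 hneg
  rcases lt_or_gt_of_ne h0 with h | h
  · rw [hneg h]
    simp
  · rw [lintegral_mul_const _ (by fun_prop), ← admConst_scale k h]
    congr 1
    refine setLIntegral_eq_of_support_subset ?_
    intro v hv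
    by_contra hv'
    have : v ≤ 0 := not_lt.1 hv'
    exact hv (by simp [psiHat, mul_nonpos_of_nonpos_of_nonneg this h.le |>.not_gt])

theorem isClosed_hardy : IsClosed (hardy : Set (Lp ℂ 2 (volume : Measure ℝ))) := by
  let R := LpToLpRestrictCLM ℝ ℂ ℂ (volume : Measure ℝ) 2 (Iio 0)
  have hR : Continuous fun h : Lp ℂ 2 (volume : Measure ℝ) => R (𝓕 h) :=
    R.continuous.comp (Lp.fourierTransformₗᵢ ℝ ℂ).continuous
  have e : (hardy : Set (Lp ℂ 2 (volume : Measure ℝ))) = {h | R (𝓕 h) = 0} := by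
    ext h
    change (∀ᵐ ξ : ℝ, ξ ∈ Iio (0 : ℝ) → (𝓕 h : Lp ℂ 2 (volume : Measure ℝ)) ξ = 0) ↔
      R (𝓕 h) = 0
    rw [Lp.eq_zero_iff_ae_eq_zero]
    have h1 : R (𝓕 h) =ᵐ[volume.restrict (Iio 0)] (𝓕 h : Lp ℂ 2 (volume : Measure ℝ)) :=
      LpToLpRestrictCLM_coeFn ℂ (Iio 0) (𝓕 h)
    rw [← ae_restrict_iff' (p := fun ξ => (𝓕 h : Lp ℂ 2 (volume : Measure ℝ)) ξ = 0)
      measurableSet_Iio]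
    exact ⟨fun h2 => h1.trans h2, fun h2 => h1.symm.trans h2⟩
  rw [e]
  exact isClosed_eq hR continuous_const

instance : CompleteSpace hardy := isClosed_hardy.completeSpace_coe

theorem eLpNorm_waveletFun (k : ℕ) (f : hardy) :
    eLpNorm (waveletFun k f.1) 2 nu = admConst k ^ (1 / 2 : ℝ) * eLpNorm f.1 2 volume := by
  rw [eLpNorm_eq_lintegral_rpow_enorm_toReal (by norm_num) (by norm_num),
    eLpNorm_eq_lintegral_rpow_enorm_toReal (by norm_num) (by norm_num)]
  simp only [ENNReal.toReal_ofNat]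
  rw [lintegral_waveletFun, ENNReal.mul_rpow_of_nonneg _ _ (by norm_num)]

theorem memLp_waveletFun (k : ℕ) (f : hardy) : MemLp (waveletFun k f.1) 2 nu := by
  refine ⟨aestronglyMeasurable_waveletFun k f.1, ?_⟩
  rw [eLpNorm_waveletFun]
  exact ENNReal.mul_lt_top (ENNReal.rpow_lt_top_of_nonneg (by norm_num) (admConst_ne_top k))
    (Lp.memLp f.1).2

/-- The continuous wavelet transform as a linear map from the Hardy space to `L₂(G, dν)`. -/
def waveletTransform (k : ℕ) : hardy →ₗ[ℂ] Lp ℂ 2 nu where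
  toFun f := (memLp_waveletFun k f).toLp (waveletFun k f.1)
  map_add' f g := by
    rw [← MemLp.toLp_add]
    refine MemLp.toLp_congr _ _ ?_
    filter_upwards [ae_nu_pos] with ζ hζ
    rw [Pi.add_apply, waveletFun_eq_inner k _ ⟨ζ, hζ⟩, waveletFun_eq_inner k _ ⟨ζ, hζ⟩,
      waveletFun_eq_inner k _ ⟨ζ, hζ⟩, Submodule.coe_add, inner_add_right]
  map_smul' c f := by
    rw [RingHom.id_apply, ← MemLp.toLp_const_smul]
    refine MemLp.toLp_congr _ _ ?_
    filter_upwards [ae_nu_pos] with ζ hζ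
    rw [Pi.smul_apply, waveletFun_eq_inner k _ ⟨ζ, hζ⟩, waveletFun_eq_inner k _ ⟨ζ, hζ⟩,
      Submodule.coe_smul, inner_smul_right, smul_eq_mul]

/-- The wavelet subspace `A^{(k)} = {W_k f : f ∈ H₂⁺(ℝ)}` of `L₂(G, dν)`. -/
def waveletSpace (k : ℕ) : Submodule ℂ (Lp ℂ 2 nu) := LinearMap.range (waveletTransform k)

theorem norm_waveletTransform (k : ℕ) (f : hardy) :
    ‖waveletTransform k f‖ = (admConst k ^ (1 / 2 : ℝ)).toReal * ‖f‖ := by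
  change ‖(memLp_waveletFun k f).toLp (waveletFun k f.1)‖ = _ * ‖f.1‖
  rw [Lp.norm_toLp, eLpNorm_waveletFun, ENNReal.toReal_mul, Lp.norm_def]

theorem isClosed_waveletSpace (k : ℕ) : IsClosed (waveletSpace k : Set (Lp ℂ 2 nu)) := by
  have hc : 0 < (admConst k ^ (1 / 2 : ℝ)).toReal := by
    refine ENNReal.toReal_pos ?_ ?_
    · simp [admConst_ne_zero]
    · exact (ENNReal.rpow_lt_top_of_nonneg (by norm_num) (admConst_ne_top k)).ne
  let c : NNReal := ⟨(admConst k ^ (1 / 2 : ℝ)).toReal, hc.le⟩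
  have h1 : AntilipschitzWith c⁻¹ (waveletTransform k) :=
    AddMonoidHomClass.antilipschitz_of_bound _ fun f => by
      rw [norm_waveletTransform, NNReal.coe_inv]
      change ‖f‖ ≤ (admConst k ^ (1 / 2 : ℝ)).toReal⁻¹ * _
      rw [inv_mul_cancel_left₀ hc.ne']
  have h2 : LipschitzWith c (waveletTransform k) :=
    AddMonoidHomClass.lipschitz_of_bound_nnnorm _ _ fun f => by
      rw [← NNReal.coe_le_coe, NNReal.coe_mul, coe_nnnorm, coe_nnnorm, norm_waveletTransform]
      exact le_rfl
  rw [waveletSpace, LinearMap.coe_range]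
  exact h1.isClosed_range h2.uniformContinuous

instance (k : ℕ) : CompleteSpace (waveletSpace k) := (isClosed_waveletSpace k).completeSpace_coe

theorem memLp_vertical {a : ℝ → ℂ} (ha : MemLp a ∞ ((volume : Measure ℝ).restrict (Ioi 0))) :
    MemLp (fun ζ : ℝ × ℝ => a ζ.2) ∞ nu := by
  have hq : Measure.QuasiMeasurePreserving Prod.snd nu
      ((volume : Measure ℝ).restrict (Ioi 0)) :=
    Measure.quasiMeasurePreserving_snd.mono_right (withDensity_absolutelyContinuous _ _)
  have hb : ∀ᵐ v ∂((volume : Measure ℝ).restrict (Ioi 0)),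
      ‖a v‖ ≤ (eLpNormEssSup a ((volume : Measure ℝ).restrict (Ioi 0))).toReal := by
    filter_upwards [ae_le_eLpNormEssSup (f := a)
      (μ := (volume : Measure ℝ).restrict (Ioi 0))] with v hv
    have h := ENNReal.toReal_mono (eLpNorm_exponent_top (f := a) ▸ ha.2.ne) hv
    rwa [toReal_enorm] at h
  exact memLp_top_of_bound (ha.1.comp_quasiMeasurePreserving hq) _ (hq.ae hb)

/-- The symbol on `G` given by an essentially bounded function of `v > 0` alone. -/
def verticalSymbol (a : ℝ → ℂ) (ha : MemLp a ∞ ((volume : Measure ℝ).restrict (Ioi 0))) :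
    Lp ℂ ∞ nu := (memLp_vertical ha).toLp fun ζ => a ζ.2

/-- Pointwise multiplication by a bounded symbol, as an operator on `L₂(G, dν)`. -/
def mulOp (b : Lp ℂ ∞ nu) : Lp ℂ 2 nu →L[ℂ] Lp ℂ 2 nu :=
  (ContinuousLinearMap.mul ℂ ℂ).holderL nu ∞ 2 2 b

/-- The Calderon-Toeplitz operator `T_b^{(k)} F = P^{(k)} (b F)` on `A^{(k)}`, where `P^{(k)}` is
the orthogonal projection of `L₂(G, dν)` onto `A^{(k)}`. -/
def toeplitz (k : ℕ) (b : Lp ℂ ∞ nu) : waveletSpace k →L[ℂ] waveletSpace k :=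
  (waveletSpace k).orthogonalProjectionOnto ∘L mulOp b ∘L (waveletSpace k).subtypeL

/-- The reproducing kernel `K_ζ^{(k)}(η) = ⟨ρ_ζ ψ^{(k)}, ρ_η ψ^{(k)}⟩` (linear in `ρ_ζ ψ^{(k)}`).
In Mathlib the second argument of `⟪·, ·⟫_ℂ` is the linear one. -/
def repKernel (k : ℕ) (ζ η : G) : ℂ := ⟪rhoPsi k η, rhoPsi k ζ⟫_ℂ

/-- The function `η ↦ K_ζ^{(k)}(η) = (W_k ρ_ζ ψ^{(k)})(η)` as an element of `A^{(k)}`. -/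
def kernelVec (k : ℕ) (ζ : G) : waveletSpace k :=
  ⟨waveletTransform k ⟨rhoPsi k ζ, rhoPsi_mem_hardy k ζ⟩, LinearMap.mem_range_self _ _⟩

theorem kernelVec_ae (k : ℕ) (ζ : G) :
    ∀ᵐ η ∂nu, ∀ hη : 0 < η.2, (kernelVec k ζ : Lp ℂ 2 nu) η = repKernel k ζ ⟨η, hη⟩ := by
  filter_upwards [(memLp_waveletFun k ⟨rhoPsi k ζ, rhoPsi_mem_hardy k ζ⟩).coeFn_toLp] with η h hη
  exact h.trans (waveletFun_eq_inner k _ ⟨η, hη⟩)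

/-- The Wick function `⟨T K_ζ, K_η⟩ / ⟨K_ζ, K_η⟩` (inner products of `L₂(G, dν)`, linear in the
vector depending on `ζ`) of an operator on `A^{(k)}`. -/
def wickFunction (k : ℕ) (T : waveletSpace k →L[ℂ] waveletSpace k) (ζ η : G) : ℂ :=
  ⟪kernelVec k η, T (kernelVec k ζ)⟫_ℂ / ⟪kernelVec k η, kernelVec k ζ⟫_ℂ

/-- The Wick symbol, the restriction of the Wick function to the diagonal. -/
def wickSymbol (k : ℕ) (T : waveletSpace k →L[ℂ] waveletSpace k) (ζ : G) : ℂ :=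
  wickFunction k T ζ ζ

/-- `γ_{a,k}(ξ) = ∫_0^∞ a(v / (2ξ)) ℓ_k(v)² dv`. -/
def gammaFun (a : ℝ → ℂ) (k : ℕ) (ξ : ℝ) : ℂ :=
  ∫ v in Ioi (0 : ℝ), a (v / (2 * ξ)) * ((laguerreFun k v ^ 2 : ℝ) : ℂ)

/-- `κ_k = (2k + 1) / 2`. -/
def kappa (k : ℕ) : ℝ := (2 * k + 1) / 2

end CalderonToeplitz

end

noncomputable section

namespace CalderonToeplitz

/-! The wavelet transform turns a vertical Toeplitz operator into multiplication by `γ_{a,k}` on the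
Fourier side. For fixed `v`, the slice `u ↦ (W_k f)(u, v)` has Fourier transform `√v ψ̂(vξ) f̂(ξ)`,
so Plancherel in `u` followed by Fubini gives `∫ a(v) W_k f · conj (W_k g) dν = ∫ (∫ a(v) v⁻¹
|ψ̂(vξ)|² dv) f̂(ξ) conj ĝ(ξ) dξ`. For `ξ > 0` the weight `v⁻¹ |ψ̂(vξ)|²` equals `2ξ ℓ_k(2ξv)²`, and
the substitution `y = 2ξv` identifies the inner integral with `γ_{a,k}(ξ)`; for `ξ ≤ 0` it is zero.
This is `integral_vertical_mul_waveletFun`.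

Since `K_ζ = W_k(ρ_ζ ψ)` lies in `A^{(k)}`, the projection can be dropped from `⟨T_a K_ζ, K_η⟩`, and
inserting the explicit Fourier transforms of `ρ_ζ ψ` and `ρ_η ψ` gives the numerator of the Wick
function.

Two Laguerre moments settle the constants. `∫ ℓ_k² = 1` makes `W_k` isometric on the Hardy space, so
the denominator `⟨K_ζ, K_η⟩` is `K_ζ(η)`; `∫ y ℓ_k(y)² dy = 2k + 1` gives the diagonal value `κ_k`.
Both moments follow from a binomial identity. -/

/-! ### Moments of the squared Laguerre functions -/

/-- Up to the sign `(-1)^k`, the left side is the `k`-th forward difference of `x ↦ C(x, n)` at `x =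
n`. Each difference lowers the bottom index by one, which leaves `C(n, n - k) = C(n, k)` if `k ≤ n`
and zero otherwise. -/
theorem sum_neg_one_pow_choose_mul_choose (k n : ℕ) :
    ∑ i ∈ Finset.range (k + 1), (-1 : ℤ) ^ i * (k.choose i : ℤ) * ((n + i).choose n : ℤ) =
      (-1) ^ k * (n.choose k : ℤ) := by
  have h := fwdDiff_iter_eq_sum_shift (1 : ℕ) (fun x : ℕ => (x.choose n : ℤ)) k n
  have h2 : (fwdDiff (1 : ℕ))^[k] (fun x : ℕ => (x.choose n : ℤ)) n = (n.choose k : ℤ) := by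
    rcases le_or_gt k n with hk | hk
    · obtain ⟨m, rfl⟩ := Nat.exists_eq_add_of_le hk
      have := congrFun (fwdDiff_iter_choose m k) (k + m)
      rw [this]
      exact_mod_cast Nat.choose_symm_of_eq_add (by omega)
    · obtain ⟨m, rfl⟩ := Nat.exists_eq_add_of_lt hk
      have := fwdDiff_iter_choose 0 n
      -- After `n` differences the function is the constant `1`; one more kills it, and the
      -- remaining `m` act on zero.
      rw [Nat.choose_eq_zero_of_lt hk, show n + m + 1 = m + (1 + n) by omega,
        Function.iterate_add_apply, Function.iterate_add_apply]
      simp only [add_zero] at this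
      rw [this]
      simp_rw [Nat.choose_zero_right, Function.iterate_one, Nat.cast_one, fwdDiff_const,
        fwdDiff_iter_eq_sum_shift, smul_zero, Finset.sum_const_zero, Nat.cast_zero]
  rw [← h2, h, Finset.mul_sum]
  refine Finset.sum_congr rfl fun i hi => ?_
  have hi' : i ≤ k := by simpa [Nat.lt_succ_iff] using hi
  obtain ⟨j, rfl⟩ := Nat.exists_eq_add_of_le hi'
  simp only [smul_eq_mul, mul_one, Nat.add_sub_cancel_left]
  have : (-1 : ℤ) ^ (i + j) * (-1) ^ j = (-1) ^ i := by
    rw [pow_add, mul_assoc, ← mul_pow]; simp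
  rw [← mul_assoc, ← mul_assoc, this]

theorem integrableOn_pow_mul_exp_neg (n : ℕ) :
    IntegrableOn (fun y : ℝ => y ^ n * Real.exp (-y)) (Ioi 0) := by
  have h := Real.GammaIntegral_convergent (s := (n : ℝ) + 1) (by positivity)
  refine h.congr_fun (fun y _ => ?_) measurableSet_Ioi
  simp only [add_sub_cancel_right, Real.rpow_natCast]
  ring

theorem integral_pow_mul_exp_neg (n : ℕ) :
    ∫ y in Ioi (0 : ℝ), y ^ n * Real.exp (-y) = (n.factorial : ℝ) := by
  rw [← Real.Gamma_nat_eq_factorial, Real.Gamma_eq_integral (by positivity)]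
  refine setIntegral_congr_fun measurableSet_Ioi fun y _ => ?_
  simp only [add_sub_cancel_right, Real.rpow_natCast]
  ring

theorem pow_mul_laguerrePoly_mul_exp_neg (k n : ℕ) (y : ℝ) :
    y ^ n * laguerrePoly k y * Real.exp (-y) = ∑ i ∈ Finset.range (k + 1),
      ((-1) ^ i * (k.choose (k - i) : ℝ) / (i.factorial : ℝ)) * (y ^ (n + i) * Real.exp (-y)) := by
  rw [laguerrePoly, Finset.mul_sum, Finset.sum_mul]
  refine Finset.sum_congr rfl fun i _ => ?_
  rw [pow_add]
  ring

theorem integrableOn_pow_mul_laguerrePoly (k n : ℕ) :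
    IntegrableOn (fun y : ℝ => y ^ n * laguerrePoly k y * Real.exp (-y)) (Ioi 0) := by
  simp only [pow_mul_laguerrePoly_mul_exp_neg]
  exact integrable_finsetSum _ fun i _ => (integrableOn_pow_mul_exp_neg _).const_mul _

/-- Termwise Gamma integrals reduce this to the binomial identity. The value vanishes for `n < k`,
which is the orthogonality of `L_k` to lower powers and makes most terms drop out below. -/
theorem integral_pow_mul_laguerrePoly (k n : ℕ) :
    ∫ y in Ioi (0 : ℝ), y ^ n * laguerrePoly k y * Real.exp (-y) =
      (-1) ^ k * (n.factorial : ℝ) * (n.choose k : ℝ) := by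
  simp only [pow_mul_laguerrePoly_mul_exp_neg]
  rw [integral_finsetSum _ fun i _ => (integrableOn_pow_mul_exp_neg _).const_mul _]
  simp only [integral_const_mul, integral_pow_mul_exp_neg]
  have h := congrArg (fun z : ℤ => (n.factorial : ℝ) * (z : ℝ))
    (sum_neg_one_pow_choose_mul_choose k n)
  push_cast at h
  rw [Finset.mul_sum] at h
  rw [show (-1 : ℝ) ^ k * (n.factorial : ℝ) * (n.choose k : ℝ) =
    (n.factorial : ℝ) * ((-1) ^ k * (n.choose k : ℝ)) by ring, ← h]
  refine Finset.sum_congr rfl fun i hi => ?_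
  have hi' : i ≤ k := by simpa [Nat.lt_succ_iff] using hi
  rw [Nat.choose_symm hi']
  have h1 : ((n + i).factorial : ℝ) =
      (n + i).choose n * (n.factorial : ℝ) * (i.factorial : ℝ) := by
    have := Nat.add_choose_mul_factorial_mul_factorial n i
    exact_mod_cast (Nat.choose_symm_add (a := n) (b := i) ▸ this).symm
  rw [h1]
  field_simp

/-- Only one of the two Laguerre factors is expanded, so that the orthogonality of the other one
remains usable. -/
theorem pow_mul_laguerreFun_sq (k n : ℕ) (y : ℝ) :
    y ^ n * laguerreFun k y ^ 2 = ∑ i ∈ Finset.range (k + 1),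
      ((-1) ^ i * (k.choose (k - i) : ℝ) / (i.factorial : ℝ)) *
        (y ^ (n + i) * laguerrePoly k y * Real.exp (-y)) := by
  have he : Real.exp (-y / 2) ^ 2 = Real.exp (-y) := by
    rw [← Real.exp_nat_mul]; congr 1; push_cast; ring
  rw [laguerreFun, mul_pow, he, sq (laguerrePoly k y)]
  nth_rewrite 1 [laguerrePoly]
  rw [Finset.sum_mul, Finset.mul_sum, Finset.mul_sum]
  refine Finset.sum_congr rfl fun i _ => ?_
  rw [pow_add]
  ring

theorem integrableOn_pow_mul_laguerreFun_sq (k n : ℕ) :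
    IntegrableOn (fun y : ℝ => y ^ n * laguerreFun k y ^ 2) (Ioi 0) := by
  simp only [pow_mul_laguerreFun_sq]
  exact integrable_finsetSum _ fun i _ => (integrableOn_pow_mul_laguerrePoly _ _).const_mul _

theorem integral_pow_mul_laguerreFun_sq (k n : ℕ) :
    ∫ y in Ioi (0 : ℝ), y ^ n * laguerreFun k y ^ 2 = ∑ i ∈ Finset.range (k + 1),
      ((-1) ^ i * (k.choose (k - i) : ℝ) / (i.factorial : ℝ)) *
        ((-1) ^ k * ((n + i).factorial : ℝ) * ((n + i).choose k : ℝ)) := by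
  simp only [pow_mul_laguerreFun_sq]
  rw [integral_finsetSum _ fun i _ => (integrableOn_pow_mul_laguerrePoly _ _).const_mul _]
  simp only [integral_const_mul, integral_pow_mul_laguerrePoly]

theorem integrableOn_laguerreFun_sq (k : ℕ) :
    IntegrableOn (fun y : ℝ => laguerreFun k y ^ 2) (Ioi 0) := by
  simpa using integrableOn_pow_mul_laguerreFun_sq k 0

theorem integral_laguerreFun_sq (k : ℕ) : ∫ y in Ioi (0 : ℝ), laguerreFun k y ^ 2 = 1 := by
  have h := integral_pow_mul_laguerreFun_sq k 0
  simp only [pow_zero, one_mul, zero_add] at h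
  rw [h, Finset.sum_range_succ, Finset.sum_eq_zero, zero_add]
  · have : (-1 : ℝ) ^ k * (-1) ^ k = 1 := by rw [← mul_pow]; simp
    simp only [Nat.sub_self, Nat.choose_zero_right, Nat.choose_self, Nat.cast_one, mul_one]
    field_simp
    exact (sq _).trans this
  · intro i hi
    rw [Nat.choose_eq_zero_of_lt (Finset.mem_range.1 hi)]
    simp

/-- By orthogonality only the two top coefficients of the expanded factor contribute: `i = k` gives
`(k + 1)²` and `i = k - 1` gives `-k²`. -/
theorem integral_mul_laguerreFun_sq (k : ℕ) :
    ∫ y in Ioi (0 : ℝ), y * laguerreFun k y ^ 2 = 2 * k + 1 := by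
  have h := integral_pow_mul_laguerreFun_sq k 1
  simp only [pow_one] at h
  rw [h, Finset.sum_range_succ]
  have hs : (-1 : ℝ) ^ k * (-1) ^ k = 1 := by rw [← mul_pow]; simp
  have e1 : (-1 : ℝ) ^ k * (k.choose (k - k) : ℝ) / (k.factorial : ℝ) *
      ((-1) ^ k * ((1 + k).factorial : ℝ) * ((1 + k).choose k : ℝ)) = (k + 1) ^ 2 := by
    rw [add_comm 1 k, Nat.factorial_succ, Nat.choose_succ_self_right]
    simp only [Nat.sub_self, Nat.choose_zero_right]
    push_cast
    field_simp
    linear_combination hs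
  rw [e1]
  rcases k with _ | m
  · simp
  rw [Finset.sum_range_succ, Finset.sum_eq_zero]
  · have hs : (-1 : ℝ) ^ m * (-1) ^ m = 1 := by rw [← mul_pow]; simp
    rw [add_comm 1 m, Nat.factorial_succ, Nat.add_sub_cancel_left, Nat.choose_one_right,
      Nat.choose_self, pow_succ]
    push_cast
    field_simp
    linear_combination (-(m + 1 : ℝ) ^ 2) * hs
  · intro i hi
    rw [Nat.choose_eq_zero_of_lt
      (show 1 + i < m + 1 by have := Finset.mem_range.1 hi; omega)]
    simp

/-! ### Admissibility constant and isometry of the wavelet transform -/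

theorem psiHat_of_pos (k : ℕ) {ξ : ℝ} (hξ : 0 < ξ) :
    psiHat k ξ = ((√(2 * ξ) * laguerreFun k (2 * ξ) : ℝ) : ℂ) :=
  indicator_of_mem (mem_Ioi.2 hξ) _

theorem psiHat_of_nonpos (k : ℕ) {ξ : ℝ} (hξ : ξ ≤ 0) : psiHat k ξ = 0 :=
  indicator_of_notMem (notMem_Ioi.2 hξ) _

theorem norm_psiHat_sq_of_pos (k : ℕ) {ξ : ℝ} (hξ : 0 < ξ) :
    ‖psiHat k ξ‖ ^ 2 = 2 * ξ * laguerreFun k (2 * ξ) ^ 2 := by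
  rw [psiHat_of_pos k hξ, Complex.norm_real, Real.norm_eq_abs, sq_abs, mul_pow,
    Real.sq_sqrt (by positivity)]

theorem integrableOn_laguerreFun_comp_mul_sq (k : ℕ) {c : ℝ} (hc : 0 < c) :
    IntegrableOn (fun v : ℝ => c * laguerreFun k (c * v) ^ 2) (Ioi 0) := by
  have h := (integrableOn_Ioi_comp_mul_left_iff (fun y => laguerreFun k y ^ 2) 0 hc).2
    (by simpa using integrableOn_laguerreFun_sq k)
  exact h.const_mul c

theorem integral_laguerreFun_comp_mul_sq (k : ℕ) {c : ℝ} (hc : 0 < c) :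
    ∫ v in Ioi (0 : ℝ), c * laguerreFun k (c * v) ^ 2 = 1 := by
  rw [integral_const_mul, integral_comp_mul_left_Ioi (fun y => laguerreFun k y ^ 2) 0 hc,
    mul_zero, integral_laguerreFun_sq, smul_eq_mul, mul_one, mul_inv_cancel₀ hc.ne']

/-- For `w > 0` the integrand `|ψ̂(w)|² / w` is `2 ℓ_k(2w)²`, the normalised density with dilation
factor `c = 2`. -/
theorem admConst_eq_one (k : ℕ) : admConst k = 1 := by
  have h := ofReal_integral_eq_lintegral_ofReal
    (integrableOn_laguerreFun_comp_mul_sq k (c := 2) (by norm_num))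
    (.of_forall fun v => by dsimp only; positivity)
  rw [integral_laguerreFun_comp_mul_sq k (by norm_num), ENNReal.ofReal_one] at h
  rw [h, admConst, ← lintegral_indicator measurableSet_Ioi]
  refine lintegral_congr fun w => ?_
  by_cases hw : w ∈ Ioi (0 : ℝ)
  · have h0 : (0 : ℝ) < w := hw
    rw [indicator_of_mem hw, ← ofReal_norm, ENNReal.ofReal_rpow_of_nonneg (norm_nonneg _)
      (by norm_num), ← ENNReal.ofReal_mul (by positivity), Real.rpow_two,
      norm_psiHat_sq_of_pos k h0]
    congr 1
    field_simp
  · rw [indicator_of_notMem hw, psiHat_of_nonpos k (not_lt.1 hw)]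
    simp

theorem inner_waveletTransform (k : ℕ) (f g : hardy) :
    ⟪waveletTransform k f, waveletTransform k g⟫_ℂ = ⟪f, g⟫_ℂ := by
  refine (LinearMap.norm_map_iff_inner_map_map (waveletTransform k)).1 (fun h => ?_) f g
  rw [norm_waveletTransform, admConst_eq_one]
  simp

/-! ### The dilation density and `γ` as an average against it -/

/-- The density `v⁻¹ |ψ̂(vξ)|²` of the vertical dilations at the frequency `ξ`. -/
def dilationWeight (k : ℕ) (v ξ : ℝ) : ℝ := v⁻¹ * ‖psiHat k (v * ξ)‖ ^ 2

theorem measurable_dilationWeight (k : ℕ) :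
    Measurable fun p : ℝ × ℝ => dilationWeight k p.1 p.2 := by
  have hp := measurable_psiHat k
  unfold dilationWeight
  fun_prop

theorem dilationWeight_of_pos (k : ℕ) {v ξ : ℝ} (hv : 0 < v) (hξ : 0 < ξ) :
    dilationWeight k v ξ = 2 * ξ * laguerreFun k (2 * ξ * v) ^ 2 := by
  rw [dilationWeight, norm_psiHat_sq_of_pos k (mul_pos hv hξ),
    show 2 * (v * ξ) = 2 * ξ * v by ring]
  field_simp

theorem dilationWeight_of_nonpos (k : ℕ) {v ξ : ℝ} (hv : 0 < v) (hξ : ξ ≤ 0) :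
    dilationWeight k v ξ = 0 := by
  rw [dilationWeight, psiHat_of_nonpos k (mul_nonpos_of_nonneg_of_nonpos hv.le hξ)]
  simp

theorem dilationWeight_nonneg (k : ℕ) {v : ℝ} (hv : 0 < v) (ξ : ℝ) :
    0 ≤ dilationWeight k v ξ := by
  unfold dilationWeight
  positivity

theorem integrableOn_dilationWeight (k : ℕ) (ξ : ℝ) :
    IntegrableOn (fun v => dilationWeight k v ξ) (Ioi 0) := by
  rcases le_or_gt ξ 0 with hξ | hξ
  · exact integrableOn_zero.congr_fun (fun v hv => (dilationWeight_of_nonpos k hv hξ).symm)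
      measurableSet_Ioi
  · exact (integrableOn_laguerreFun_comp_mul_sq k (c := 2 * ξ) (by positivity)).congr_fun
      (fun v hv => (dilationWeight_of_pos k hv hξ).symm) measurableSet_Ioi

theorem integral_dilationWeight_of_pos (k : ℕ) {ξ : ℝ} (hξ : 0 < ξ) :
    ∫ v in Ioi (0 : ℝ), dilationWeight k v ξ = 1 := by
  rw [← integral_laguerreFun_comp_mul_sq k (c := 2 * ξ) (by positivity)]
  exact setIntegral_congr_fun measurableSet_Ioi fun v hv => dilationWeight_of_pos k hv hξ

theorem integral_dilationWeight_of_nonpos (k : ℕ) {ξ : ℝ} (hξ : ξ ≤ 0) :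
    ∫ v in Ioi (0 : ℝ), dilationWeight k v ξ = 0 := by
  rw [setIntegral_congr_fun measurableSet_Ioi
    (fun v hv => dilationWeight_of_nonpos k hv hξ), integral_zero]

/-- The substitution `y = 2ξv` moves the dependence on `ξ` from the argument of the symbol to a
probability density in `v`. In this form `γ` is the inner integral produced by Fubini. -/
theorem gammaFun_eq_integral_dilationWeight (b : ℝ → ℂ) (k : ℕ) {ξ : ℝ} (hξ : 0 < ξ) :
    gammaFun b k ξ = ∫ v in Ioi (0 : ℝ), b v * (dilationWeight k v ξ : ℂ) := by
  have hc : 0 < 2 * ξ := by positivity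
  have h := integral_comp_mul_left_Ioi
    (fun y => b (y / (2 * ξ)) * ((laguerreFun k y ^ 2 : ℝ) : ℂ)) 0 hc
  rw [mul_zero] at h
  have e : ∀ v ∈ Ioi (0 : ℝ), b v * (dilationWeight k v ξ : ℂ) = ((2 * ξ : ℝ) : ℂ) *
      (b (2 * ξ * v / (2 * ξ)) * ((laguerreFun k (2 * ξ * v) ^ 2 : ℝ) : ℂ)) := by
    intro v hv
    rw [dilationWeight_of_pos k hv hξ, mul_div_cancel_left₀ _ hc.ne']
    push_cast
    ring
  rw [setIntegral_congr_fun measurableSet_Ioi e, integral_const_mul, h, gammaFun,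
    Complex.real_smul, ← mul_assoc, ← Complex.ofReal_mul, mul_inv_cancel₀ hc.ne',
    Complex.ofReal_one, one_mul]

/-- Justifies Fubini: integrating in `v` first, the weight has mass one for `ξ > 0` and zero for `ξ
≤ 0`, so the integrability of `F` suffices, and the bounded factor `b` does no harm. -/
theorem integrable_dilationWeight_mul (k : ℕ) {b : ℝ → ℂ} {M : ℝ} (hb : Measurable b)
    (hM : ∀ v, ‖b v‖ ≤ M) {F : ℝ → ℂ} (hF : Integrable F) :
    Integrable (fun p : ℝ × ℝ => b p.1 * (dilationWeight k p.1 p.2 : ℂ) * F p.2)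
      (((volume : Measure ℝ).restrict (Ioi 0)).prod volume) := by
  have hw := measurable_dilationWeight k
  have hFm : AEStronglyMeasurable (fun p : ℝ × ℝ => F p.2)
      (((volume : Measure ℝ).restrict (Ioi 0)).prod volume) := hF.1.comp_snd
  have hm : AEStronglyMeasurable (fun p : ℝ × ℝ => (dilationWeight k p.1 p.2 : ℂ) * F p.2)
      (((volume : Measure ℝ).restrict (Ioi 0)).prod volume) :=
    (Complex.measurable_ofReal.comp hw).aestronglyMeasurable.mul hFm
  have hi : Integrable (fun p : ℝ × ℝ => (dilationWeight k p.1 p.2 : ℂ) * F p.2)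
      (((volume : Measure ℝ).restrict (Ioi 0)).prod volume) := by
    rw [integrable_prod_iff' hm]
    refine ⟨.of_forall fun ξ => (integrableOn_dilationWeight k ξ).ofReal.mul_const (F ξ), ?_⟩
    have e : (fun ξ => ∫ v in Ioi (0 : ℝ), ‖(dilationWeight k v ξ : ℂ) * F ξ‖) =
        (Ioi (0 : ℝ)).indicator fun ξ => ‖F ξ‖ := by
      ext ξ
      have e1 : ∀ v ∈ Ioi (0 : ℝ), ‖(dilationWeight k v ξ : ℂ) * F ξ‖ =
          dilationWeight k v ξ * ‖F ξ‖ := fun v hv => by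
        rw [norm_mul, Complex.norm_real, Real.norm_of_nonneg (dilationWeight_nonneg k hv ξ)]
      rw [setIntegral_congr_fun measurableSet_Ioi e1, integral_mul_const]
      rcases le_or_gt ξ 0 with hξ | hξ
      · rw [integral_dilationWeight_of_nonpos k hξ, indicator_of_notMem (notMem_Ioi.2 hξ),
          zero_mul]
      · rw [integral_dilationWeight_of_pos k hξ, indicator_of_mem (mem_Ioi.2 hξ), one_mul]
    rw [e]
    exact hF.norm.indicator measurableSet_Ioi
  simp only [mul_assoc]
  exact hi.bdd_mul (hb.comp measurable_fst).aestronglyMeasurable (.of_forall fun p => hM p.1)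

/-! ### Plancherel on horizontal slices and the spectral form of vertical symbols -/

theorem integral_waveletFun_slice (k : ℕ) (f g : Lp ℂ 2 (volume : Measure ℝ)) {v : ℝ}
    (hv : 0 < v) :
    ∫ u, conj (waveletFun k g (u, v)) * waveletFun k f (u, v) =
      ∫ ξ, ((v * ‖psiHat k (v * ξ)‖ ^ 2 : ℝ) : ℂ) *
        (conj ((𝓕 g : Lp ℂ 2 (volume : Measure ℝ)) ξ) *
          (𝓕 f : Lp ℂ 2 (volume : Measure ℝ)) ξ) := by
  -- Each slice is the `L₂` inverse Fourier transform of an explicit product, so the unitarity of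
  -- the Fourier transform applies to the pair.
  have H : ∀ h : Lp ℂ 2 (volume : Measure ℝ), ∃ m : Lp ℂ 2 (volume : Measure ℝ),
      (m =ᵐ[volume] fun ξ => rhoPsiHat k (0, v) ξ * (𝓕 h : Lp ℂ 2 (volume : Measure ℝ)) ξ) ∧
      ((𝓕⁻ m : Lp ℂ 2 (volume : Measure ℝ)) =ᵐ[volume] fun u => waveletFun k h (u, v)) := by
    intro h
    have hf : MemLp (𝓕 h : Lp ℂ 2 (volume : Measure ℝ)) 2 volume := Lp.memLp _
    have g1 : Integrable fun ξ : ℝ => rhoPsiHat k (0, v) ξ *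
        (𝓕 h : Lp ℂ 2 (volume : Measure ℝ)) ξ :=
      (memLp_two_rhoPsiHat k (ζ := (0, v)) hv).integrable_mul hf
    have g2 : MemLp (fun ξ : ℝ => rhoPsiHat k (0, v) ξ *
        (𝓕 h : Lp ℂ 2 (volume : Measure ℝ)) ξ) 2 :=
      hf.mul (memLp_top_rhoPsiHat k (0, v))
    refine ⟨g2.toLp _, g2.coeFn_toLp, (fourierInv_toLp_ae g1 g2).trans (.of_forall fun u => ?_)⟩
    exact (waveletFun_eq_fourierInv k h ⟨(u, v), hv⟩).symm
  obtain ⟨mf, hf1, hf2⟩ := H f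
  obtain ⟨mg, hg1, hg2⟩ := H g
  have key := Lp.inner_fourier_eq (𝓕⁻ mg) (𝓕⁻ mf)
  rw [FourierTransform.fourier_fourierInv_eq, FourierTransform.fourier_fourierInv_eq,
    L2.inner_def, L2.inner_def] at key
  refine Eq.trans ?_ (key.symm.trans ?_)
  · refine integral_congr_ae ?_
    filter_upwards [hf2, hg2] with u h1 h2
    rw [h1, h2, RCLike.inner_apply, mul_comm]
  · refine integral_congr_ae ?_
    filter_upwards [hf1, hg1] with ξ h1 h2
    have hn := norm_rhoPsiHat k (0, v) ξ
    have hs : v * ‖psiHat k (v * ξ)‖ ^ 2 = ‖rhoPsiHat k (0, v) ξ‖ ^ 2 := by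
      rw [hn, mul_pow, Real.sq_sqrt hv.le]
    rw [h1, h2, RCLike.inner_apply, hs, map_mul, Complex.ofReal_pow, ← Complex.mul_conj']
    ring

theorem integral_vertical_mul_waveletFun (k : ℕ) {b : ℝ → ℂ} {M : ℝ} (hb : Measurable b)
    (hM : ∀ v, ‖b v‖ ≤ M) (f g : hardy) :
    ∫ ζ, b ζ.2 * (conj (waveletFun k g.1 ζ) * waveletFun k f.1 ζ) ∂nu =
      ∫ ξ in Ioi (0 : ℝ), gammaFun b k ξ *
        (conj ((𝓕 g.1 : Lp ℂ 2 (volume : Measure ℝ)) ξ) *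
          (𝓕 f.1 : Lp ℂ 2 (volume : Measure ℝ)) ξ) := by
  have hFi : Integrable fun ξ => conj ((𝓕 g.1 : Lp ℂ 2 (volume : Measure ℝ)) ξ) *
      (𝓕 f.1 : Lp ℂ 2 (volume : Measure ℝ)) ξ :=
    (Lp.memLp (𝓕 g.1 : Lp ℂ 2 (volume : Measure ℝ))).star.integrable_mul (Lp.memLp _)
  set F : ℝ → ℂ := fun ξ => conj ((𝓕 g.1 : Lp ℂ 2 (volume : Measure ℝ)) ξ) *
      (𝓕 f.1 : Lp ℂ 2 (volume : Measure ℝ)) ξ with hF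
  have hi : Integrable (fun ζ : ℝ × ℝ => b ζ.2 *
      (conj (waveletFun k g.1 ζ) * waveletFun k f.1 ζ)) nu :=
    ((memLp_waveletFun k g).star.integrable_mul (memLp_waveletFun k f)).bdd_mul
      (hb.comp measurable_snd).aestronglyMeasurable (.of_forall fun p => hM p.2)
  rw [nu] at hi ⊢
  rw [integral_prod_symm _ hi, integral_withDensity_eq_integral_toReal_smul (by fun_prop)
    (.of_forall fun _ => ENNReal.ofReal_lt_top)]
  -- The density `v⁻²` of `ν` and the factor `v` from the slice combine to the `v⁻¹` of the dilation
  -- density.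
  have s1 : ∀ v ∈ Ioi (0 : ℝ), (ENNReal.ofReal (v ^ 2)⁻¹).toReal •
      (∫ u, b v * (conj (waveletFun k g.1 (u, v)) * waveletFun k f.1 (u, v))) =
      ∫ ξ, b v * (dilationWeight k v ξ : ℂ) * F ξ := by
    intro v hv
    have hv' : (0 : ℝ) < v := hv
    rw [ENNReal.toReal_ofReal (by positivity), integral_const_mul,
      integral_waveletFun_slice k f.1 g.1 hv', ← integral_const_mul, ← integral_smul]
    refine integral_congr_ae (.of_forall fun ξ => ?_)
    simp only [dilationWeight, Complex.real_smul, hF]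
    have hvc : (v : ℂ) ≠ 0 := Complex.ofReal_ne_zero.2 hv'.ne'
    push_cast
    field_simp
  rw [setIntegral_congr_fun measurableSet_Ioi s1,
    integral_integral_swap (integrable_dilationWeight_mul k hb hM hFi),
    ← setIntegral_eq_integral_of_ae_compl_eq_zero (s := Ioi (0 : ℝ))]
  · refine setIntegral_congr_fun measurableSet_Ioi fun ξ hξ => ?_
    rw [integral_mul_const, gammaFun_eq_integral_dilationWeight b k hξ]
  -- Frequencies `ξ ≤ 0` contribute nothing because `ψ̂(vξ) = 0` there.
  · refine .of_forall fun ξ hξ => ?_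
    rw [setIntegral_congr_fun measurableSet_Ioi (g := fun _ => (0 : ℂ)), integral_zero]
    intro v hv
    simp only
    rw [dilationWeight_of_nonpos k hv (not_lt.1 hξ), Complex.ofReal_zero, mul_zero, zero_mul]

/-! ### Bounds for `γ` and passage to essentially bounded symbols -/

theorem norm_gammaFun_le (k : ℕ) {b : ℝ → ℂ} {M : ℝ} (hM : ∀ v, ‖b v‖ ≤ M) {ξ : ℝ}
    (hξ : 0 < ξ) : ‖gammaFun b k ξ‖ ≤ M := by
  rw [gammaFun_eq_integral_dilationWeight b k hξ]
  have h : ∀ᵐ v ∂((volume : Measure ℝ).restrict (Ioi 0)),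
      ‖b v * (dilationWeight k v ξ : ℂ)‖ ≤ M * dilationWeight k v ξ := by
    filter_upwards [ae_restrict_mem measurableSet_Ioi] with v hv
    have h0 := dilationWeight_nonneg k hv ξ
    rw [norm_mul, Complex.norm_real, Real.norm_of_nonneg h0]
    exact mul_le_mul_of_nonneg_right (hM v) h0
  refine (norm_integral_le_of_norm_le ((integrableOn_dilationWeight k ξ).const_mul M) h).trans ?_
  rw [integral_const_mul, integral_dilationWeight_of_pos k hξ, mul_one]

theorem aestronglyMeasurable_gammaFun (k : ℕ) {b : ℝ → ℂ} (hb : Measurable b) :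
    AEStronglyMeasurable (gammaFun b k) ((volume : Measure ℝ).restrict (Ioi 0)) := by
  have hw := Complex.measurable_ofReal.comp (measurable_dilationWeight k)
  have hm : StronglyMeasurable fun p : ℝ × ℝ => b p.1 * (dilationWeight k p.1 p.2 : ℂ) :=
    ((hb.comp measurable_fst).mul hw).stronglyMeasurable
  refine (hm.integral_prod_left' (μ := (volume : Measure ℝ).restrict (Ioi 0))
    ).aestronglyMeasurable.congr ?_
  filter_upwards [ae_restrict_mem measurableSet_Ioi] with ξ hξ
  exact (gammaFun_eq_integral_dilationWeight b k hξ).symm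

/-- A measurable representative is set to zero wherever it exceeds the essential supremum. Fubini is
carried out for this representative; neither the operator nor `γ` notices the change. -/
theorem exists_bounded_measurable_representative {a : ℝ → ℂ} {μ : Measure ℝ}
    (ha : MemLp a ∞ μ) :
    ∃ (b : ℝ → ℂ) (M : ℝ), Measurable b ∧ (∀ v, ‖b v‖ ≤ M) ∧ a =ᵐ[μ] b := by
  let c := ha.1.mk a
  have hc : Measurable c := ha.1.stronglyMeasurable_mk.measurable
  let M := (eLpNormEssSup a μ).toReal
  have hb : ∀ᵐ v ∂μ, ‖a v‖ ≤ M := by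
    filter_upwards [ae_le_eLpNormEssSup (f := a) (μ := μ)] with v hv
    have h := ENNReal.toReal_mono (eLpNorm_exponent_top (f := a) ▸ ha.2.ne) hv
    rwa [toReal_enorm] at h
  refine ⟨{v | ‖c v‖ ≤ M}.indicator c, M, hc.indicator (measurableSet_le hc.norm
    measurable_const), fun v => ?_, ?_⟩
  · by_cases hv : v ∈ {v | ‖c v‖ ≤ M}
    · rw [indicator_of_mem hv]
      exact hv
    · rw [indicator_of_notMem hv, norm_zero]
      exact ENNReal.toReal_nonneg
  · filter_upwards [hb, ha.1.ae_eq_mk] with v h1 h2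
    rw [indicator_of_mem (by simpa [c, ← h2] using h1), h2]

/-- Dilations preserve null sets. Hence `γ` is unchanged at every `ξ > 0`, not just at almost every
one. -/
theorem ae_comp_div_of_ae {a b : ℝ → ℂ} (hab : a =ᵐ[(volume : Measure ℝ).restrict (Ioi 0)] b)
    {c : ℝ} (hc : 0 < c) :
    ∀ᵐ v ∂((volume : Measure ℝ).restrict (Ioi 0)), a (v / c) = b (v / c) := by
  rw [Filter.EventuallyEq, ae_restrict_iff' measurableSet_Ioi] at hab
  rw [ae_restrict_iff' measurableSet_Ioi]
  have hq : Measure.QuasiMeasurePreserving (fun v : ℝ => v * c⁻¹) volume volume :=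
    ⟨by fun_prop, by
      rw [Real.map_volume_mul_right (inv_ne_zero hc.ne')]
      exact Measure.smul_absolutelyContinuous⟩
  filter_upwards [hq.ae hab] with v h hv
  exact h (mul_pos hv (inv_pos.2 hc))

theorem gammaFun_congr_ae {a b : ℝ → ℂ}
    (hab : a =ᵐ[(volume : Measure ℝ).restrict (Ioi 0)] b) (k : ℕ) {ξ : ℝ} (hξ : 0 < ξ) :
    gammaFun a k ξ = gammaFun b k ξ := by
  refine integral_congr_ae ?_
  filter_upwards [ae_comp_div_of_ae hab (c := 2 * ξ) (by positivity)] with v h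
  rw [h]

/-! ### Fourier form of the kernels and the diagonal value -/

/-- The square-root amplitudes multiply to `√t √(2tξ) √v √(2vξ) = 2tvξ`, and the phases combine to
`e^{-2πiξ(u-s)}`. -/
theorem conj_rhoPsiHat_mul_rhoPsiHat (k : ℕ) (ζ η : G) {ξ : ℝ} (hξ : 0 < ξ) :
    conj (rhoPsiHat k η.1 ξ) * rhoPsiHat k ζ.1 ξ = 2 * (η.1.2 : ℂ) * (ζ.1.2 : ℂ) *
      (((laguerreFun k (2 * ζ.1.2 * ξ) * laguerreFun k (2 * η.1.2 * ξ) : ℝ) : ℂ) *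
        Complex.exp (-2 * Real.pi * Complex.I * ξ * (ζ.1.1 - η.1.1 : ℝ)) * (ξ : ℂ)) := by
  obtain ⟨⟨u, v⟩, hv⟩ := ζ
  obtain ⟨⟨s, t⟩, ht⟩ := η
  simp only at hv ht ⊢
  rw [rhoPsiHat, rhoPsiHat, psiHat_of_pos k (mul_pos hv hξ), psiHat_of_pos k (mul_pos ht hξ)]
  simp only [map_mul, Complex.conj_ofReal, ← Complex.exp_conj, Complex.conj_I]
  have e1 : Complex.exp (-2 * Real.pi * Complex.I * ξ * (u - s : ℝ)) =
      Complex.exp (((-2 * Real.pi * (ξ * s) : ℝ) : ℂ) * -Complex.I) *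
      Complex.exp (((-2 * Real.pi * (ξ * u) : ℝ) : ℂ) * Complex.I) := by
    rw [← Complex.exp_add]
    congr 1
    push_cast
    ring
  have e2 : √t * √(2 * (t * ξ)) * (√v * √(2 * (v * ξ))) = 2 * t * v * ξ := by
    rw [← Real.sqrt_mul ht.le, ← Real.sqrt_mul hv.le,
      show t * (2 * (t * ξ)) = t ^ 2 * (2 * ξ) by ring,
      show v * (2 * (v * ξ)) = v ^ 2 * (2 * ξ) by ring,
      Real.sqrt_mul (sq_nonneg t), Real.sqrt_mul (sq_nonneg v), Real.sqrt_sq ht.le,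
      Real.sqrt_sq hv.le]
    linear_combination t * v * Real.mul_self_sqrt (show 0 ≤ 2 * ξ by positivity)
  have e2' := congrArg (fun x : ℝ => (x : ℂ)) e2
  push_cast at e2'
  rw [e1, mul_assoc 2 v ξ, mul_assoc 2 t ξ]
  push_cast
  linear_combination ((laguerreFun k (2 * (v * ξ)) : ℂ) * (laguerreFun k (2 * (t * ξ)) : ℂ) *
    (Complex.exp ((-2 * Real.pi * (ξ * s)) * -Complex.I) *
      Complex.exp ((-2 * Real.pi * (ξ * u)) * Complex.I))) * e2'

/-- With `u = s = 0` the phase is `1`, so the integrand is a constant times a product of two `L₂`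
functions. -/
theorem integrableOn_laguerreFun_mul_laguerreFun_mul (k : ℕ) {v t : ℝ} (hv : 0 < v)
    (ht : 0 < t) : IntegrableOn (fun ξ : ℝ =>
      ((laguerreFun k (2 * v * ξ) * laguerreFun k (2 * t * ξ) * ξ : ℝ) : ℂ)) (Ioi 0) := by
  have h : Integrable fun ξ => conj (rhoPsiHat k (0, t) ξ) * rhoPsiHat k (0, v) ξ :=
    (memLp_two_rhoPsiHat k (ζ := (0, t)) ht).star.integrable_mul
      (memLp_two_rhoPsiHat k (ζ := (0, v)) hv)
  refine IntegrableOn.congr_fun (h.integrableOn.const_mul (2 * (t : ℂ) * v)⁻¹) (fun ξ hξ => ?_)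
    measurableSet_Ioi
  have e := conj_rhoPsiHat_mul_rhoPsiHat k ⟨(0, v), hv⟩ ⟨(0, t), ht⟩ hξ
  have hv' : (v : ℂ) ≠ 0 := Complex.ofReal_ne_zero.2 hv.ne'
  have ht' : (t : ℂ) ≠ 0 := Complex.ofReal_ne_zero.2 ht.ne'
  simp only at e ⊢
  rw [e, inv_mul_cancel_left₀ (by simp [hv', ht'])]
  simp

theorem repKernel_self (k : ℕ) (ζ : G) : repKernel k ζ ζ = (kappa k : ℂ) := by
  have hv := ζ.2
  have hc : 0 < 2 * ζ.1.2 := by positivity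
  rw [repKernel, ← Lp.inner_fourier_eq, fourier_rhoPsi, L2.inner_def]
  have e1 : ∫ ξ, ⟪(memLp_two_rhoPsiHat k hv).toLp (rhoPsiHat k ζ.1) ξ,
      (memLp_two_rhoPsiHat k hv).toLp (rhoPsiHat k ζ.1) ξ⟫_ℂ =
      ∫ ξ, conj (rhoPsiHat k ζ.1 ξ) * rhoPsiHat k ζ.1 ξ := by
    refine integral_congr_ae ?_
    filter_upwards [(memLp_two_rhoPsiHat k hv).coeFn_toLp] with ξ h
    rw [h, RCLike.inner_apply, mul_comm]
  rw [e1, ← setIntegral_eq_integral_of_ae_compl_eq_zero (s := Ioi (0 : ℝ))]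
  -- Written as `v · y ℓ_k(y)²` at `y = 2vξ`; since `dξ = dy / (2v)`, the integral is half the first
  -- moment.
  · have e2 : ∀ ξ ∈ Ioi (0 : ℝ), conj (rhoPsiHat k ζ.1 ξ) * rhoPsiHat k ζ.1 ξ =
        ((ζ.1.2 * ((2 * ζ.1.2 * ξ) * laguerreFun k (2 * ζ.1.2 * ξ) ^ 2) : ℝ) : ℂ) := by
      intro ξ hξ
      rw [conj_rhoPsiHat_mul_rhoPsiHat k ζ ζ hξ]
      simp only [sub_self, Complex.ofReal_zero, mul_zero, Complex.exp_zero]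
      push_cast
      ring
    rw [setIntegral_congr_fun measurableSet_Ioi e2, integral_complex_ofReal, integral_const_mul,
      integral_comp_mul_left_Ioi (fun y => y * laguerreFun k y ^ 2) 0 hc, mul_zero,
      integral_mul_laguerreFun_sq, kappa, smul_eq_mul]
    congr 1
    field_simp
  · refine .of_forall fun ξ hξ => ?_
    rw [rhoPsiHat, psiHat_of_nonpos k (mul_nonpos_of_nonneg_of_nonpos hv.le (not_lt.1 hξ))]
    simp

theorem inner_kernelVec (k : ℕ) (ζ η : G) :
    ⟪kernelVec k η, kernelVec k ζ⟫_ℂ = repKernel k ζ η :=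
  inner_waveletTransform k ⟨rhoPsi k η, rhoPsi_mem_hardy k η⟩ ⟨rhoPsi k ζ, rhoPsi_mem_hardy k ζ⟩

/-! ### Toeplitz matrix elements and the Wick calculus -/

/-- The left vector lies in `A^{(k)}`, so the projection disappears from the inner product and only
multiplication by the symbol remains. -/
theorem inner_toeplitz_waveletTransform (k : ℕ) {a : ℝ → ℂ}
    (ha : MemLp a ∞ ((volume : Measure ℝ).restrict (Ioi 0))) (f g : hardy) :
    ⟪(⟨waveletTransform k g, LinearMap.mem_range_self _ _⟩ : waveletSpace k),
      toeplitz k (verticalSymbol a ha) ⟨waveletTransform k f, LinearMap.mem_range_self _ _⟩⟫_ℂ =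
      ∫ ξ in Ioi (0 : ℝ), gammaFun a k ξ *
        (conj ((𝓕 g.1 : Lp ℂ 2 (volume : Measure ℝ)) ξ) *
          (𝓕 f.1 : Lp ℂ 2 (volume : Measure ℝ)) ξ) := by
  obtain ⟨b, M, hb, hM, hab⟩ := exists_bounded_measurable_representative ha
  have hab' : ∀ᵐ ζ ∂nu, a ζ.2 = b ζ.2 := by
    have hq : Measure.QuasiMeasurePreserving Prod.snd nu
        ((volume : Measure ℝ).restrict (Ioi 0)) :=
      Measure.quasiMeasurePreserving_snd.mono_right (withDensity_absolutelyContinuous _ _)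
    exact hq.ae hab
  rw [toeplitz, ContinuousLinearMap.comp_apply, ContinuousLinearMap.comp_apply,
    Submodule.inner_orthogonalProjectionOnto_eq_of_mem_left, Submodule.subtypeL_apply,
    L2.inner_def]
  refine Eq.trans ?_ ((integral_vertical_mul_waveletFun k hb hM f g).trans ?_)
  · refine integral_congr_ae ?_
    have hmul : mulOp (verticalSymbol a ha) (waveletTransform k f) =ᵐ[nu]
        fun ζ => verticalSymbol a ha ζ * waveletTransform k f ζ :=
      (ContinuousLinearMap.mul ℂ ℂ).coeFn_holder (r := 2) _ _
    filter_upwards [hmul, (memLp_vertical ha).coeFn_toLp, (memLp_waveletFun k f).coeFn_toLp,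
      (memLp_waveletFun k g).coeFn_toLp, hab'] with ζ h1 h2 h3 h4 h5
    rw [h1, RCLike.inner_apply, verticalSymbol, h2, h5]
    change b ζ.2 * (memLp_waveletFun k f).toLp (waveletFun k f.1) ζ *
      conj ((memLp_waveletFun k g).toLp (waveletFun k g.1) ζ) = _
    rw [h3, h4]
    ring
  · refine setIntegral_congr_fun measurableSet_Ioi fun ξ hξ => ?_
    rw [gammaFun_congr_ae hab k hξ]

theorem inner_toeplitz_kernelVec (k : ℕ) {a : ℝ → ℂ}
    (ha : MemLp a ∞ ((volume : Measure ℝ).restrict (Ioi 0))) (ζ η : G) :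
    ⟪kernelVec k η, toeplitz k (verticalSymbol a ha) (kernelVec k ζ)⟫_ℂ =
      2 * (η.1.2 : ℂ) * (ζ.1.2 : ℂ) * ∫ ξ in Ioi (0 : ℝ), gammaFun a k ξ *
        ((laguerreFun k (2 * ζ.1.2 * ξ) * laguerreFun k (2 * η.1.2 * ξ) : ℝ) : ℂ) *
        Complex.exp (-2 * Real.pi * Complex.I * ξ * (ζ.1.1 - η.1.1 : ℝ)) * (ξ : ℂ) := by
  refine (inner_toeplitz_waveletTransform k ha ⟨rhoPsi k ζ, rhoPsi_mem_hardy k ζ⟩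
    ⟨rhoPsi k η, rhoPsi_mem_hardy k η⟩).trans ?_
  rw [← integral_const_mul]
  refine integral_congr_ae ?_
  simp only [fourier_rhoPsi]
  filter_upwards [ae_restrict_mem measurableSet_Ioi,
    ae_restrict_of_ae (memLp_two_rhoPsiHat k ζ.2).coeFn_toLp,
    ae_restrict_of_ae (memLp_two_rhoPsiHat k η.2).coeFn_toLp] with ξ hξ h1 h2
  rw [h1, h2, conj_rhoPsiHat_mul_rhoPsiHat k ζ η hξ]
  ring

theorem wickFunction_toeplitz (k : ℕ) {a : ℝ → ℂ}
    (ha : MemLp a ∞ ((volume : Measure ℝ).restrict (Ioi 0))) (ζ η : G) :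
    wickFunction k (toeplitz k (verticalSymbol a ha)) ζ η =
      2 * (η.1.2 : ℂ) * (ζ.1.2 : ℂ) / repKernel k ζ η *
        ∫ ξ in Ioi (0 : ℝ), gammaFun a k ξ *
          ((laguerreFun k (2 * ζ.1.2 * ξ) * laguerreFun k (2 * η.1.2 * ξ) : ℝ) : ℂ) *
          Complex.exp (-2 * Real.pi * Complex.I * ξ * (ζ.1.1 - η.1.1 : ℝ)) * (ξ : ℂ) := by
  rw [wickFunction, inner_kernelVec, inner_toeplitz_kernelVec]
  ring

theorem wickSymbol_toeplitz (k : ℕ) {a : ℝ → ℂ}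
    (ha : MemLp a ∞ ((volume : Measure ℝ).restrict (Ioi 0))) (ζ : G) :
    wickSymbol k (toeplitz k (verticalSymbol a ha)) ζ =
      2 * (kappa k : ℂ)⁻¹ * (ζ.1.2 : ℂ) ^ 2 * ∫ ξ in Ioi (0 : ℝ), gammaFun a k ξ *
        ((laguerreFun k (2 * ζ.1.2 * ξ) ^ 2 * ξ : ℝ) : ℂ) := by
  rw [wickSymbol, wickFunction_toeplitz, repKernel_self]
  congr 1
  · ring
  · refine integral_congr_ae (.of_forall fun ξ => ?_)
    simp only [sub_self, Complex.ofReal_zero, mul_zero, Complex.exp_zero]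
    push_cast
    ring

/-! ### Absolute convergence -/

theorem integrableOn_symbol_mul_laguerreFun_sq (k : ℕ) {a : ℝ → ℂ}
    (ha : MemLp a ∞ ((volume : Measure ℝ).restrict (Ioi 0))) {ξ : ℝ} (hξ : 0 < ξ) :
    IntegrableOn (fun v : ℝ => a (v / (2 * ξ)) * ((laguerreFun k v ^ 2 : ℝ) : ℂ)) (Ioi 0) := by
  obtain ⟨b, M, hb, hM, hab⟩ := exists_bounded_measurable_representative ha
  have h : Integrable (fun v : ℝ => b (v / (2 * ξ)) * ((laguerreFun k v ^ 2 : ℝ) : ℂ))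
      ((volume : Measure ℝ).restrict (Ioi 0)) :=
    (integrableOn_laguerreFun_sq k).ofReal.bdd_mul
      (hb.comp (measurable_id.div_const _)).aestronglyMeasurable (.of_forall fun v => hM _)
  refine h.congr ?_
  filter_upwards [ae_comp_div_of_ae hab (c := 2 * ξ) (by positivity)] with v h
  rw [h]

theorem integrableOn_gammaFun_mul (k : ℕ) {a : ℝ → ℂ}
    (ha : MemLp a ∞ ((volume : Measure ℝ).restrict (Ioi 0))) {v t : ℝ} (hv : 0 < v)
    (ht : 0 < t) : IntegrableOn (fun ξ : ℝ => gammaFun a k ξ *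
      ((laguerreFun k (2 * v * ξ) * laguerreFun k (2 * t * ξ) * ξ : ℝ) : ℂ)) (Ioi 0) := by
  obtain ⟨b, M, hb, hM, hab⟩ := exists_bounded_measurable_representative ha
  have h := (integrableOn_laguerreFun_mul_laguerreFun_mul k hv ht).bdd_mul (c := M)
    (aestronglyMeasurable_gammaFun k hb) (by
      filter_upwards [ae_restrict_mem measurableSet_Ioi] with ξ hξ
      exact norm_gammaFun_le k hM hξ)
  refine IntegrableOn.congr_fun h (fun ξ hξ => ?_) measurableSet_Ioi
  rw [gammaFun_congr_ae hab k hξ]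

end CalderonToeplitz

end

theorem mainTheorem12 (k : ℕ) (a : ℝ → ℂ)
    (ha : MeasureTheory.MemLp a ⊤ (MeasureTheory.volume.restrict (Set.Ioi (0 : ℝ)))) :
    -- the integrals below converge absolutely
    (∀ ξ : ℝ, 0 < ξ → MeasureTheory.IntegrableOn
      (fun v : ℝ => a (v / (2 * ξ)) * ((CalderonToeplitz.laguerreFun k v ^ 2 : ℝ) : ℂ))
      (Set.Ioi 0)) ∧
    (∀ v t : ℝ, 0 < v → 0 < t → MeasureTheory.IntegrableOn
      (fun ξ : ℝ => CalderonToeplitz.gammaFun a k ξ *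
        ((CalderonToeplitz.laguerreFun k (2 * v * ξ) *
          CalderonToeplitz.laguerreFun k (2 * t * ξ) * ξ : ℝ) : ℂ)) (Set.Ioi 0)) ∧
    -- the denominator of the Wick symbol is the nonzero number `κ_k`
    (∀ ζ : CalderonToeplitz.G,
      CalderonToeplitz.repKernel k ζ ζ = (CalderonToeplitz.kappa k : ℂ)) ∧
    -- the Wick symbol depends only on `v`
    (∃ w : ℝ → ℂ,
      (∀ ζ : CalderonToeplitz.G, CalderonToeplitz.wickSymbol k
        (CalderonToeplitz.toeplitz k (CalderonToeplitz.verticalSymbol a ha)) ζ = w ζ.1.2) ∧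
      ∀ v : ℝ, 0 < v → w v = 2 * ((CalderonToeplitz.kappa k : ℝ) : ℂ)⁻¹ * (v : ℂ) ^ 2 *
        ∫ ξ in Set.Ioi (0 : ℝ), CalderonToeplitz.gammaFun a k ξ *
          ((CalderonToeplitz.laguerreFun k (2 * v * ξ) ^ 2 * ξ : ℝ) : ℂ)) ∧
    -- the Wick function
    (∀ ζ η : CalderonToeplitz.G, CalderonToeplitz.repKernel k ζ η ≠ 0 →
      CalderonToeplitz.wickFunction k
        (CalderonToeplitz.toeplitz k (CalderonToeplitz.verticalSymbol a ha)) ζ η =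
      2 * (η.1.2 : ℂ) * (ζ.1.2 : ℂ) / CalderonToeplitz.repKernel k ζ η *
        ∫ ξ in Set.Ioi (0 : ℝ), CalderonToeplitz.gammaFun a k ξ *
          ((CalderonToeplitz.laguerreFun k (2 * ζ.1.2 * ξ) *
            CalderonToeplitz.laguerreFun k (2 * η.1.2 * ξ) : ℝ) : ℂ) *
          Complex.exp (-2 * Real.pi * Complex.I * ξ * (ζ.1.1 - η.1.1 : ℝ)) * (ξ : ℂ)) := by
  exact ⟨fun ξ hξ => CalderonToeplitz.integrableOn_symbol_mul_laguerreFun_sq k ha hξ,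
    fun v t hv ht => CalderonToeplitz.integrableOn_gammaFun_mul k ha hv ht,
    CalderonToeplitz.repKernel_self k,
    -- The witness is the integral formula itself, read as a function of `v`, since `u` does not
    -- occur in it.
    ⟨_, CalderonToeplitz.wickSymbol_toeplitz k ha, fun v _ => rfl⟩,
    fun ζ η _ => CalderonToeplitz.wickFunction_toeplitz k ha ζ η⟩
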